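/- **Setting.** Let $\mathcal X$ be a separable topological space with its Borel $\sigma$-algebra, $k:\mathcal X\times\mathcal X\to\mathbb R$ a continuous kernel with $k(u,u)\le B_k$ for all $u$, and $H=H(k)$ its reproducing kernel Hilbert space (RKHS). For a Borel probability measure $x$ on $\mathcal X$ let $\mu_x=\int k(\cdot,u)\,dx(u)\in H$ be its mean embedding, and let $X=\{\mu_x\}\subseteq H$ be the set of all mean embeddings. Let $K:X\times X\to\mathbb R$ be a kernel with RKHS $\mathcal H=\mathcal H(K)$ and $K(\mu_a,\mu_a)\le B_K$ for all $\mu_a\in X$, whose feature map is Hölder continuous: $\|K(\cdot,\mu_a)-K(\cdot,\mu_b)\|_{\mathcal H}\le L\,\|\mu_a-\mu_b\|_H^h$ with $L\ge 0$, $0<h\le 1$. Let $\mathcal M$ be a distribution of pairs $(x,y)$, $x$ a probability measure on $\mathcal X$ (with the $\sigma$-algebra generated by the maps $x\mapsto x(A)$, $A$ Borel) and $y\in\mathbb R$, with $|y|\le C$ almost surely ($C>0$). Let $\rho$ be the law of $(\mu_x,y)$ on $X\times\mathbb R$, $\rho_X$ its marginal on $X$, $\rho(\cdot\mid\mu_a)$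 its conditional distributions. For $f\in\mathcal H$ let $\mathcal E[f]=\mathbb E\,(f(\mu_x)-y)^2$. Assume that a minimizer $f_{\mathcal H}$ of $\mathcal E$ over $\mathcal H$ exists and that for some $M,\Sigma>0$, for $\rho_X$-almost every $\mu_a$, $$\int_{\mathbb R}\Big(e^{|y-f_{\mathcal H}(\mu_a)|/M}-\tfrac{|y-f_{\mathcal H}(\mu_a)|}{M}-1\Big)\,d\rho(y\mid\mu_a)\le\frac{\Sigma^2}{2M^2}.$$ Let $l,N\ge1$. The sample consists of $l$ i.i.d. pairs $(x_i,y_i)\sim\mathcal M$ and, given these, of independent bags $x_{i,1},\dots,x_{i,N}$ drawn i.i.d. from $x_i$; $\hat x_i=\frac1N\sum_{n}\delta_{x_{i,n}}$. For $\lambda>0$ the MERR estimator is $$f^\lambda_{\hat{\mathbf z}}=\arg\min_{f\in\mathcal H}\ \frac1l\sum_{i=1}^l\big(f(\mu_{\hat x_i})-y_i\big)^2+\lambda\|f\|_{\mathcal H}^2 .$$ Let $f^\lambda=\arg\min_{f\in\mathcal H}\mathcal E[f]+\lambda\|f\|^2_{\mathcal H}$, $T_{\mu_a}f=f(\mu_a)K(\cdot,\mu_a)$,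 $T=\int_X T_{\mu_a}\,d\rho_X(\mu_a)$, and $$\mathscr A(\lambda)=\|\sqrt T(f^\lambda-f_{\mathcal H})\|^2_{\mathcal H},\quad \mathscr B(\lambda)=\|f^\lambda-f_{\mathcal H}\|^2_{\mathcal H},\quad \mathscr N(\lambda)=\operatorname{Tr}\big[(T+\lambda)^{-1}T\big].$$ **Theorem.** Let $0<\eta<1$, $\delta>0$, $C_\eta=32\log^2(6/\eta)$, and suppose that $$l\ge\frac{2C_\eta B_K\mathscr N(\lambda)}{\lambda},\qquad \lambda\le\|T\|_{\mathcal L(\mathcal H)},\qquad N\ge\frac{\big(1+\sqrt{\log l+\delta}\big)^2\,2^{\frac{h+6}{h}}\,B_k\,B_K^{1/h}\,L^{2/h}}{\lambda^{2/h}} .$$ Then with probability at least $1-\eta-e^{-\delta}$ $$\mathcal E[f^\lambda_{\hat{\mathbf z}}]-\mathcal E[f_{\mathcal H}]\le 5\Bigg\{\frac{4L^2C^2\big(1+\sqrt{\log l+\delta}\big)^{2h}(2B_k)^h}{\lambda N^h}\Big[1+\frac{4B_K^2}{\lambda^2}\Big]+\mathscr A(\lambda)+C_\eta\Big[\frac{B_K^2\mathscr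 B(\lambda)}{l^2\lambda}+\frac{B_K\mathscr A(\lambda)}{4l\lambda}+\frac{B_KM^2}{l^2\lambda}+\frac{\Sigma^2\mathscr N(\lambda)}{l}\Big]\Bigg\}.$$ -/

import Mathlib

open MeasureTheory ProbabilityTheory
open scoped ENNReal NNReal

namespace DistReg

noncomputable section

/-! ### Generalities -/

section General

/-- A minimizer of `J` over the whole type (some junk point if there is none). -/
def argmin {E : Type*} [Nonempty E] (J : E → ℝ) : E :=
  Classical.epsilon fun f => ∀ g, J f ≤ J g

variable {E : Type*} [NormedAddCommGroup E] [InnerProductSpace ℝ E] [CompleteSpace E]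

/-- The positive square root of a positive bounded operator on a Hilbert space
(junk if there is none). -/
def opSqrt (A : E →L[ℝ] E) : E →L[ℝ] E :=
  Classical.epsilon fun S : E →L[ℝ] E => S.IsPositive ∧ S ∘L S = A

/-- The trace `∑ᵢ ⟪A eᵢ, eᵢ⟫` of an operator on a Hilbert space, computed in an orthonormal
(Hilbert) basis; for trace class operators it does not depend on the basis. -/
def opTrace (A : E →L[ℝ] E) : ℝ :=
  ∑' i, inner ℝ (A ((exists_hilbertBasis ℝ E).choose_spec.choose i))
    ((exists_hilbertBasis ℝ E).choose_spec.choose i)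

/-- The resolvent `(A + lam)⁻¹`. -/
def resolv (A : E →L[ℝ] E) (lam : ℝ) : E →L[ℝ] E :=
  Ring.inverse (A + lam • ContinuousLinearMap.id ℝ E)

end General

/-! ### Real-valued reproducing kernel Hilbert spaces -/

section Kernels

variable {S : Type*} (E : Type*) [NormedAddCommGroup E] [InnerProductSpace ℝ E] [CompleteSpace E]
  [RKHS ℝ E S ℝ]

/-- The value `κ(s, t)` of the real-valued reproducing kernel of `E`. -/
def kerVal (s t : S) : ℝ := RKHS.kernel E s t 1

/-- The canonical feature map `t ↦ κ(·, t)` with values in `E`. -/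
def feature (t : S) : E := RKHS.kerFun E t 1

/-- The rank-one operator `f ↦ f(t) κ(·, t)`. -/
def pointOp (t : S) : E →L[ℝ] E :=
  ((ContinuousLinearMap.proj (R := ℝ) (φ := fun _ : S => ℝ) t) ∘L
    (RKHS.coeCLM ℝ : E →L[ℝ] S → ℝ)).smulRight (feature E t)

end Kernels

/-! ### Mean embeddings -/

section Embeddings

variable {𝒳 : Type*} [MeasurableSpace 𝒳] (H : Type*) [NormedAddCommGroup H]
  [InnerProductSpace ℝ H] [CompleteSpace H] [RKHS ℝ H 𝒳 ℝ]

/-- The mean embedding `μ_x = ∫ k(·, u) dx(u)`. -/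
def meanEmb (x : ProbabilityMeasure 𝒳) : H := ∫ u, feature H u ∂(x : Measure 𝒳)

/-- The set `X` of all mean embeddings of probability measures, a subset of `H`. -/
def embSet : Set H := Set.range (meanEmb H)

/-- The mean embedding as a point of `X`. -/
def toEmb (x : ProbabilityMeasure 𝒳) : embSet H := ⟨meanEmb H x, Set.mem_range_self x⟩

/-- The empirical distribution of a bag of `N ≥ 1` points. -/
def empirical {N : ℕ} [NeZero N] (s : Fin N → 𝒳) : ProbabilityMeasure 𝒳 :=
  ⟨(N : ℝ≥0∞)⁻¹ • ∑ n, Measure.dirac (s n), ⟨by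
    simp [ENNReal.inv_mul_cancel (Nat.cast_ne_zero.2 (NeZero.ne N)) (ENNReal.natCast_ne_top N)]⟩⟩

end Embeddings

/-! ### Two-stage sampling -/

section Sampling

variable {𝒳 : Type*} [MeasurableSpace 𝒳]

/-- Given `(x, y)`, a bag consists of `N` independent draws from `x`. -/
def bagKernel (𝒳 : Type*) [MeasurableSpace 𝒳] (N : ℕ) :
    Kernel (ProbabilityMeasure 𝒳 × ℝ) (Fin N → 𝒳) where
  toFun p := Measure.pi fun _ => (p.1 : Measure 𝒳)
  measurable' := by
    refine Measurable.measure_of_isPiSystem_of_isProbabilityMeasure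
      generateFrom_pi.symm isPiSystem_pi ?_
    rintro _ ⟨t, ht, rfl⟩
    simp only [Measure.pi_pi]
    refine Finset.measurable_prod _ fun i _ => ?_
    exact (Measure.measurable_coe (ht i (Set.mem_univ i))).comp
      (measurable_subtype_coe.comp measurable_fst)

instance (N : ℕ) : IsMarkovKernel (bagKernel 𝒳 N) :=
  ⟨fun p => by change IsProbabilityMeasure (Measure.pi fun _ => (p.1 : Measure 𝒳)); infer_instance⟩

/-- The law of the two-stage sample: the triples `((xᵢ, yᵢ), (xᵢₙ)ₙ)`, `i = 1, …, l`, are i.i.d.,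
`(xᵢ, yᵢ)` is drawn from the meta distribution and the bag is drawn from `xᵢ`. -/
def sampleLaw (Q : Measure (ProbabilityMeasure 𝒳 × ℝ)) (l N : ℕ) :
    Measure (Fin l → (ProbabilityMeasure 𝒳 × ℝ) × (Fin N → 𝒳)) :=
  Measure.pi fun _ => Q ⊗ₘ bagKernel 𝒳 N

end Sampling

/-! ### The regression problem -/

section Regression

variable {𝒳 : Type*} [MeasurableSpace 𝒳] (H : Type*) [NormedAddCommGroup H]
  [InnerProductSpace ℝ H] [CompleteSpace H] [MeasurableSpace H] [RKHS ℝ H 𝒳 ℝ]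

/-- The distribution `ρ` on `X × ℝ` induced by the meta distribution via `(x, y) ↦ (μ_x, y)`. -/
def rho (Q : Measure (ProbabilityMeasure 𝒳 × ℝ)) : Measure (embSet H × ℝ) :=
  Q.map fun p => (toEmb H p.1, p.2)

instance (Q : Measure (ProbabilityMeasure 𝒳 × ℝ)) [IsFiniteMeasure Q] :
    IsFiniteMeasure (rho H Q) := by
  unfold rho; infer_instance

variable {H} {F : Type*} [NormedAddCommGroup F] [InnerProductSpace ℝ F]
  [RKHS ℝ F (embSet H) ℝ]

/-- The expected risk `𝓔[f] = 𝔼 (f(μ_x) - y)²`. -/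
def risk (Q : Measure (ProbabilityMeasure 𝒳 × ℝ)) (f : F) : ℝ :=
  ∫ z, (f z.1 - z.2) ^ 2 ∂(rho H Q)

/-- The noise condition with constants `M`, `Sig` on the conditional distributions `ρ(y | a)`
around the values `fH a`; the integrand is nonnegative. -/
def NoiseBound (Q : Measure (ProbabilityMeasure 𝒳 × ℝ)) [IsFiniteMeasure Q]
    (fH : F) (M Sig : ℝ) : Prop :=
  ∀ᵐ a ∂(rho H Q).fst,
    ∫⁻ y, ENNReal.ofReal (Real.exp (|y - fH a| / M) - |y - fH a| / M - 1)
      ∂((rho H Q).condKernel a) ≤ ENNReal.ofReal (Sig ^ 2 / (2 * M ^ 2))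

variable (F) in
/-- The regularized population solution `f^λ`. -/
def fReg (Q : Measure (ProbabilityMeasure 𝒳 × ℝ)) (lam : ℝ) : F :=
  argmin fun f : F => risk Q f + lam * ‖f‖ ^ 2

variable (F) in
/-- The estimator `f^λ_ẑ`: kernel ridge regression on the embeddings of the empirical
distributions of the bags. It only uses the bags and the labels. -/
def merr {l N : ℕ} [NeZero N] (lam : ℝ)
    (w : Fin l → (ProbabilityMeasure 𝒳 × ℝ) × (Fin N → 𝒳)) : F :=
  argmin fun f : F =>
    (1 / (l : ℝ)) * ∑ i, (f (toEmb H (empirical (w i).2)) - (w i).1.2) ^ 2 + lam * ‖f‖ ^ 2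

variable [CompleteSpace F]

variable (F) in
/-- The covariance operator `T = ∫ T_a dρ_X(a)`. -/
def covOp (Q : Measure (ProbabilityMeasure 𝒳 × ℝ)) : F →L[ℝ] F :=
  ∫ a, pointOp F a ∂(rho H Q).fst

/-- The residual `𝓐(λ) = ‖√T (f^λ - f_𝓗)‖²`. -/
def residual (Q : Measure (ProbabilityMeasure 𝒳 × ℝ)) (fH : F) (lam : ℝ) : ℝ :=
  ‖opSqrt (covOp F Q) (fReg F Q lam - fH)‖ ^ 2

/-- The reconstruction error `𝓑(λ) = ‖f^λ - f_𝓗‖²`. -/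
def reconErr (Q : Measure (ProbabilityMeasure 𝒳 × ℝ)) (fH : F) (lam : ℝ) : ℝ :=
  ‖fReg F Q lam - fH‖ ^ 2

variable (F) in
/-- The effective dimension `𝓝(λ) = Tr ((T + λ)⁻¹ T)`. -/
def effDim (Q : Measure (ProbabilityMeasure 𝒳 × ℝ)) (lam : ℝ) : ℝ :=
  opTrace (resolv (covOp F Q) lam ∘L covOp F Q)

end Regression

/-- The constant `C_η = 32 log² (6 / η)`. -/
def Ceta (η : ℝ) : ℝ := 32 * Real.log (6 / η) ^ 2

end

end DistReg

/-! By the reproducing property the risk is a quadratic functional, `⟪T f, f⟫ - 2⟪g, f⟫` plus a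
constant. A minimizer `fH` therefore solves the normal equation `T fH = g`, the excess risk of `f`
is exactly `⟪T (f - fH), f - fH⟫`, and both the population and the empirical regularized solutions
are resolvents applied to data. The theorem is thus a statement about perturbing `(T + λ)⁻¹ T fH`.

Write `B`, `B'` for the empirical second moment operators at the true and at the bag embeddings, and
`g'`, `g''` for the corresponding data vectors. The error of the estimator splits into five vectors:
`(B' + λ)⁻¹` applied to `g'' - g'` and to `(B - B') f_z`, where `f_z = (B + λ)⁻¹ g'` (bag error);
the bias `f^λ - fH`; and `(B + λ)⁻¹` applied to the noise `g' - B fH` and to `(T - B)(f^λ - fH)`.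
The factor 5 is the price of squaring a sum of five terms (`inner_sub_resolv_le`).

Replacing `T` by empirical operators needs only the quadratic form inequality `T ≤ 2B + λ`. It holds
once the average of `(Vφ) ⊗ (Vφ)`, with `V = √((T + λ)⁻¹)`, is within 1/2 of its mean in
Hilbert–Schmidt norm (`measure_not_loewner_le`); the lower bound on `l` ensures this. The lower
bound on `N` makes `‖B - B'‖ ≤ λ/4`, so that `B'` inherits a similar inequality.

Three events, each failing with probability at most `η/3`, come from one Hilbert space Bernstein
inequality (`measure_norm_sum_gt_le`), proved with the potential `cosh ‖·‖`: the form inequality,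
the deviation of `B (f^λ - fH)`, and the weighted noise (`measure_noise_gt_le`). The bags are
controlled by a bounded differences inequality (`measure_norm_sum_gt_le_of_oscillation_le`) at level
`log l + δ`, so that a union bound over the `l` bags costs `exp (-δ)`. -/

namespace DistReg

/-! ### Sums of independent vectors in a Hilbert space -/

/-! ### Convexity of the hyperbolic cosine and bounds for `exp u - u - 1`. -/

section HyperbolicCosine

/-- The series of `cosh r` is a power series in `r ^ 2` with nonnegative coefficients, so `cosh` is
convex as a function of the square; the comparison is made term by term. -/
theorem cosh_le_of_sq_eq {p u v r : ℝ} (hp : 0 ≤ p) (hp1 : p ≤ 1)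
    (hr : r ^ 2 = p * u ^ 2 + (1 - p) * v ^ 2) :
    Real.cosh r ≤ p * Real.cosh u + (1 - p) * Real.cosh v := by
  refine hasSum_le (fun n => ?_) (Real.hasSum_cosh r)
    (((Real.hasSum_cosh u).mul_left p).add ((Real.hasSum_cosh v).mul_left (1 - p)))
  have h := (convexOn_pow (𝕜 := ℝ) n).2 (Set.mem_Ici.2 (sq_nonneg u)) (Set.mem_Ici.2 (sq_nonneg v))
    hp (sub_nonneg.2 hp1) (by ring)
  simp only [smul_eq_mul] at h
  rw [← hr] at h
  simp only [pow_mul]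
  rw [← mul_div_assoc, ← mul_div_assoc, ← add_div]
  gcongr

variable {E : Type*} [NormedAddCommGroup E] [InnerProductSpace ℝ E]

/-- One step of the exponential martingale argument: the term linear in `x` vanishes on averaging
over a centred `x`, leaving a multiplicative factor for `cosh ‖s‖`. At `s = 0` the quotient `sinh 0
/ 0` is 0, which is harmless because the inner product is 0 too. -/
theorem cosh_norm_add_le (s x : E) :
    Real.cosh ‖s + x‖ ≤ Real.cosh ‖s‖ * (Real.exp ‖x‖ - ‖x‖)
      + Real.sinh ‖s‖ / ‖s‖ * inner ℝ s x := by
  set a := ‖s‖ with ha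
  set b := ‖x‖ with hb
  have ha0 : 0 ≤ a := norm_nonneg s
  have hb0 : 0 ≤ b := norm_nonneg x
  obtain ⟨q, hq1, hq2, hq⟩ : ∃ q : ℝ, -1 ≤ q ∧ q ≤ 1 ∧ inner ℝ s x = q * (a * b) := by
    have habs := abs_le.1 (abs_real_inner_le_norm s x)
    rcases eq_or_lt_of_le (mul_nonneg ha0 hb0) with h0 | h0
    · refine ⟨0, by norm_num, by norm_num, ?_⟩
      rw [← ha, ← hb, ← h0] at habs
      linarith [habs.1, habs.2]
    · refine ⟨inner ℝ s x / (a * b), ?_, ?_, (div_mul_cancel₀ _ h0.ne').symm⟩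
      · rw [le_div_iff₀ h0]; linarith [habs.1]
      · rw [div_le_iff₀ h0]; linarith [habs.2]
  -- The squared norm interpolates between the two collinear cases `(a + b) ^ 2` and `(a - b) ^ 2`.
  -- Convexity then gives `cosh a cosh b + q sinh a sinh b`, and the claim reduces to `q sinh a
  -- (sinh b - b) ≤ cosh a (sinh b - b)`.
  have hsq : ‖s + x‖ ^ 2 = ((1 + q) / 2) * (a + b) ^ 2 + (1 - (1 + q) / 2) * (a - b) ^ 2 := by
    rw [norm_add_sq_real, hq]; ring
  have h1 := cosh_le_of_sq_eq (by linarith) (by linarith) hsq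
  rw [Real.cosh_add, Real.cosh_sub] at h1
  have h2 : Real.sinh a / a * inner ℝ s x = q * (b * Real.sinh a) := by
    rw [hq]
    rcases eq_or_lt_of_le ha0 with h0 | h0
    · simp [← h0]
    · field_simp
  rw [h2, ← Real.cosh_add_sinh b]
  have h3 : 0 ≤ Real.sinh b - b := sub_nonneg.2 (Real.self_le_sinh_iff.2 hb0)
  have h4 : 0 ≤ Real.sinh a := Real.sinh_nonneg_iff.2 ha0
  have h5 : Real.sinh a ≤ Real.cosh a := (Real.sinh_lt_cosh a).le
  nlinarith [mul_nonneg h3 (sub_nonneg.2 h5), mul_nonneg (mul_nonneg h3 h4) (sub_nonneg.2 hq2)]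

theorem exp_sub_self_sub_one_nonneg (u : ℝ) : 0 ≤ Real.exp u - u - 1 := by
  linarith [Real.add_one_le_exp u]

theorem exp_sub_self_sub_one_le_sq {u : ℝ} (h0 : 0 ≤ u) (h1 : u ≤ 1) :
    Real.exp u - u - 1 ≤ u ^ 2 := by
  have := (abs_le.1 (Real.abs_exp_sub_one_sub_id_le (abs_le.2 ⟨by linarith, h1⟩))).2
  linarith

/-- The series starts at order two, so scaling by `c ≤ 1` gains at least `c ^ 2` in every term. This
transfers the exponential noise condition to rescaled vectors. -/
theorem exp_mul_sub_le {c u : ℝ} (hc : 0 ≤ c) (hc1 : c ≤ 1) (hu : 0 ≤ u) :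
    Real.exp (c * u) - c * u - 1 ≤ c ^ 2 * (Real.exp u - u - 1) := by
  have key : ∀ v : ℝ, HasSum (fun n : ℕ => v ^ (n + 2) / (n + 2).factorial)
      (Real.exp v - v - 1) := by
    intro v
    have h := NormedSpace.expSeries_div_hasSum_exp (𝔸 := ℝ) v
    rw [← Real.exp_eq_exp_ℝ] at h
    have h2 := (hasSum_nat_add_iff' 2).2 h
    simpa [Finset.sum_range_succ, sub_sub, add_comm] using h2
  refine hasSum_le (fun n => ?_) (key (c * u)) ((key u).mul_left (c ^ 2))
  rw [← mul_div_assoc]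
  rw [mul_pow]
  gcongr ?_ * _ / _
  exact pow_le_pow_of_le_one hc hc1 (by omega)

end HyperbolicCosine

/-! ### Peeling off independent summands one at a time. -/

section Iteration

variable {Ω : Type*} [MeasurableSpace Ω] (P : Measure Ω) [IsProbabilityMeasure P]

theorem lintegral_pi_succ {n : ℕ} {f : (Fin (n + 1) → Ω) → ℝ≥0∞} (hf : Measurable f) :
    ∫⁻ w, f w ∂(Measure.pi fun _ => P)
      = ∫⁻ x, ∫⁻ w, f (Fin.cons x w) ∂(Measure.pi fun _ : Fin n => P) ∂P := by
  have h := (measurePreserving_piFinSuccAbove (fun _ : Fin (n + 1) => P) 0).symm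
  rw [← h.lintegral_comp_emb (MeasurableEquiv.measurableEmbedding _)]
  rw [lintegral_prod _ (by
    exact (hf.comp (MeasurableEquiv.measurable _)).aemeasurable)]
  simp [MeasurableEquiv.piFinSuccAbove_symm_apply, Fin.insertNthEquiv]

variable {E : Type*} [NormedAddCommGroup E]

/-- A supermartingale argument without filtrations: `Φ n s` bounds the expectation when the partial
sum is `s` and `n` draws remain. The Bernstein, second moment and bounded differences estimates are
three choices of `Φ`. -/
theorem lintegral_pi_sum_le {ξ : Ω → E} (hξ : StronglyMeasurable ξ) (Φ : ℕ → E → ℝ≥0∞)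
    (hΦ : Continuous (Φ 0)) (hstep : ∀ n s, ∫⁻ x, Φ n (s + ξ x) ∂P ≤ Φ (n + 1) s) (n : ℕ) :
    ∀ s, ∫⁻ w, Φ 0 (s + ∑ i, ξ (w i)) ∂(Measure.pi fun _ : Fin n => P) ≤ Φ n s := by
  induction n with
  | zero => intro s; simp
  | succ n ih =>
    intro s
    rw [lintegral_pi_succ P]
    · refine (lintegral_mono fun x => ?_).trans (hstep n s)
      simpa [Fin.sum_univ_succ, add_assoc] using ih (s + ξ x)
    · have : StronglyMeasurable fun w : Fin (n + 1) → Ω => s + ∑ i, ξ (w i) :=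
        stronglyMeasurable_const.add (Finset.stronglyMeasurable_fun_sum _ fun i _ =>
          hξ.comp_measurable (measurable_pi_apply i))
      exact (hΦ.comp_stronglyMeasurable this).measurable

end Iteration

/-! ### Bernstein's inequality through the potential `cosh ‖·‖`. -/

section Bernstein

variable {Ω : Type*} [MeasurableSpace Ω] (P : Measure Ω) [IsProbabilityMeasure P]
variable {E : Type*} [NormedAddCommGroup E]

theorem stronglyMeasurable_pi_sum {ξ : Ω → E} (hξ : StronglyMeasurable ξ) (n : ℕ) :
    StronglyMeasurable fun w : Fin n → Ω => ∑ i, ξ (w i) :=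
  Finset.stronglyMeasurable_fun_sum _ fun i _ => hξ.comp_measurable (measurable_pi_apply i)

variable [InnerProductSpace ℝ E] [CompleteSpace E]

theorem lintegral_cosh_le {ξ : Ω → E} (hξ : StronglyMeasurable ξ) (hint : Integrable ξ P)
    (hmean : ∫ ω, ξ ω ∂P = 0) {κ : ℝ} (hκ : 0 ≤ κ)
    (hφ : ∫⁻ ω, ENNReal.ofReal (Real.exp ‖ξ ω‖ - ‖ξ ω‖ - 1) ∂P ≤ ENNReal.ofReal κ) (s : E) :
    ∫⁻ ω, ENNReal.ofReal (Real.cosh ‖s + ξ ω‖) ∂P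
      ≤ ENNReal.ofReal (Real.cosh ‖s‖ * (1 + κ)) := by
  have hφm : AEStronglyMeasurable (fun ω => Real.exp ‖ξ ω‖ - ‖ξ ω‖ - 1) P :=
    (((Real.continuous_exp.comp_stronglyMeasurable hξ.norm).sub hξ.norm).sub
      stronglyMeasurable_const).aestronglyMeasurable
  have hφi : Integrable (fun ω => Real.exp ‖ξ ω‖ - ‖ξ ω‖ - 1) P := by
    refine ⟨hφm, ?_⟩
    rw [hasFiniteIntegral_iff_ofReal (ae_of_all _ fun ω => exp_sub_self_sub_one_nonneg _)]
    exact hφ.trans_lt ENNReal.ofReal_lt_top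
  have hφle : ∫ ω, (Real.exp ‖ξ ω‖ - ‖ξ ω‖ - 1) ∂P ≤ κ := by
    rw [← ofReal_integral_eq_lintegral_ofReal hφi
      (ae_of_all _ fun ω => exp_sub_self_sub_one_nonneg _)] at hφ
    exact (ENNReal.ofReal_le_ofReal_iff hκ).1 hφ
  set g : Ω → ℝ := fun ω => Real.cosh ‖s‖ * (1 + (Real.exp ‖ξ ω‖ - ‖ξ ω‖ - 1))
      + Real.sinh ‖s‖ / ‖s‖ * inner ℝ s (ξ ω) with hg
  have hle : ∀ ω, Real.cosh ‖s + ξ ω‖ ≤ g ω := fun ω =>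
    (cosh_norm_add_le s (ξ ω)).trans (le_of_eq (by simp only [hg]; ring))
  have hi1 : Integrable (fun ω => 1 + (Real.exp ‖ξ ω‖ - ‖ξ ω‖ - 1)) P :=
    (integrable_const _).add hφi
  have hi2 : Integrable (fun ω => inner ℝ s (ξ ω)) P := hint.const_inner s
  have hgi : Integrable g P := (hi1.const_mul _).add (hi2.const_mul _)
  calc ∫⁻ ω, ENNReal.ofReal (Real.cosh ‖s + ξ ω‖) ∂P
      ≤ ∫⁻ ω, ENNReal.ofReal (g ω) ∂P :=
        lintegral_mono fun ω => ENNReal.ofReal_le_ofReal (hle ω)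
    _ = ENNReal.ofReal (∫ ω, g ω ∂P) := by
        rw [ofReal_integral_eq_lintegral_ofReal hgi
          (ae_of_all _ fun ω => (Real.cosh_pos _).le.trans (hle ω))]
    _ ≤ _ := by
        apply ENNReal.ofReal_le_ofReal
        rw [hg, integral_add (hi1.const_mul _) (hi2.const_mul _), integral_const_mul,
          integral_const_mul, integral_inner hint, hmean, inner_zero_right, mul_zero, add_zero,
          integral_add (integrable_const _) hφi]
        simp only [integral_const, probReal_univ, smul_eq_mul, mul_one]
        have := Real.cosh_pos ‖s‖
        gcongr

/-- A Bernstein type inequality for sums of i.i.d. centred vectors in a Hilbert space. -/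
theorem measure_norm_sum_gt_le {ξ : Ω → E} (hξ : StronglyMeasurable ξ) (hint : Integrable ξ P)
    (hmean : ∫ ω, ξ ω ∂P = 0) {n : ℕ} (hn : 0 < n) {D : ℝ} (hD : 0 < D)
    (hφ : ∫⁻ ω, ENNReal.ofReal (Real.exp (‖ξ ω‖ / D) - ‖ξ ω‖ / D - 1) ∂P
      ≤ ENNReal.ofReal (1 / n)) {τ : ℝ} (hτ : 1 ≤ τ) :
    (Measure.pi fun _ : Fin n => P) {w | 2 * D * τ < ‖∑ i, ξ (w i)‖}
      ≤ ENNReal.ofReal (2 * Real.exp (-τ)) := by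
  set ζ : Ω → E := fun ω => D⁻¹ • ξ ω with hζ
  have hζn : ∀ ω, ‖ζ ω‖ = ‖ξ ω‖ / D := fun ω => by
    simp [hζ, norm_smul, abs_of_pos hD, div_eq_inv_mul]
  have hζm : StronglyMeasurable ζ := hξ.const_smul _
  have hζi : Integrable ζ P := hint.smul _
  have hζ0 : ∫ ω, ζ ω ∂P = 0 := by rw [hζ, integral_smul, hmean, smul_zero]
  have hn' : (0 : ℝ) < n := Nat.cast_pos.2 hn
  have key := lintegral_pi_sum_le P hζm
    (fun k s => ENNReal.ofReal (Real.cosh ‖s‖ * (1 + 1 / (n : ℝ)) ^ k))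
    (by
      simp only [pow_zero, mul_one]
      exact ENNReal.continuous_ofReal.comp (Real.continuous_cosh.comp continuous_norm)) (by
      intro k s
      have h := lintegral_cosh_le P hζm hζi hζ0 (κ := 1 / (n : ℝ)) (by positivity)
        (by simpa only [hζn] using hφ) s
      have hp : (0 : ℝ) ≤ (1 + 1 / (n : ℝ)) ^ k := by positivity
      simp only [mul_comm (Real.cosh _) ((1 + 1 / (n : ℝ)) ^ _)]
      simp only [ENNReal.ofReal_mul hp]
      rw [lintegral_const_mul' _ _ ENNReal.ofReal_ne_top, pow_succ, mul_assoc,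
        ENNReal.ofReal_mul hp, mul_comm (1 + 1 / (n : ℝ))]
      gcongr) n 0
  simp only [pow_zero, mul_one, zero_add, norm_zero, Real.cosh_zero, one_mul] at key
  -- Markov's inequality at `exp (2τ) / 2 ≤ cosh (2τ)`. The mean is at most `(1 + 1/n) ^ n ≤ e`, so
  -- the tail is at most `2 exp (1 - 2τ)`, which is at most `2 exp (-τ)` because `τ ≥ 1`.
  have hmark := mul_meas_ge_le_lintegral₀ (μ := Measure.pi fun _ : Fin n => P)
    (f := fun w => ENNReal.ofReal (Real.cosh ‖∑ i, ζ (w i)‖))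
    ((Real.continuous_cosh.comp_stronglyMeasurable
      (stronglyMeasurable_pi_sum hζm n).norm).measurable.ennreal_ofReal.aemeasurable)
    (ENNReal.ofReal (Real.exp (2 * τ) / 2))
  have hsub : {w : Fin n → Ω | 2 * D * τ < ‖∑ i, ξ (w i)‖} ⊆
      {w | ENNReal.ofReal (Real.exp (2 * τ) / 2) ≤ ENNReal.ofReal (Real.cosh ‖∑ i, ζ (w i)‖)} := by
    intro w hw
    simp only [Set.mem_ofPred_eq] at hw ⊢
    apply ENNReal.ofReal_le_ofReal
    have h1 : 2 * τ ≤ ‖∑ i, ζ (w i)‖ := by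
      rw [hζ, ← Finset.smul_sum, norm_smul, norm_inv, Real.norm_of_nonneg hD.le, inv_mul_eq_div,
        le_div_iff₀ hD]
      linarith
    rw [Real.cosh_eq]
    have := Real.exp_le_exp.2 h1
    have := Real.exp_pos (-‖∑ i, ζ (w i)‖)
    linarith
  have hexp : (1 + 1 / (n : ℝ)) ^ n ≤ Real.exp 1 := by
    calc (1 + 1 / (n : ℝ)) ^ n ≤ Real.exp (1 / n) ^ n := by
          gcongr
          linarith [Real.add_one_le_exp (1 / (n : ℝ))]
      _ = Real.exp 1 := by rw [← Real.exp_nat_mul]; congr 1; field_simp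
  have h2 := (hmark.trans key).trans (ENNReal.ofReal_le_ofReal hexp)
  refine (measure_mono hsub).trans ?_
  have hpos : 0 < Real.exp (2 * τ) / 2 := by positivity
  rw [mul_comm, ← ENNReal.le_div_iff_mul_le (Or.inl (by simpa using Real.exp_pos _))
    (Or.inl ENNReal.ofReal_ne_top), ← ENNReal.ofReal_div_of_pos hpos] at h2
  refine h2.trans (ENNReal.ofReal_le_ofReal ?_)
  rw [div_le_iff₀ hpos]
  have : 2 * Real.exp (-τ) * (Real.exp (2 * τ) / 2) = Real.exp τ := by
    rw [mul_div_assoc', mul_assoc, mul_div_assoc, ← Real.exp_add]; ring_nf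
  rw [this]
  exact Real.exp_le_exp.2 hτ

end Bernstein

/-! ### Bounded differences for the norm of a sum. -/

section Hoeffding

variable {Ω : Type*} [MeasurableSpace Ω] (P : Measure Ω) [IsProbabilityMeasure P]

theorem integral_exp_le_of_oscillation_le {X : Ω → ℝ} (hX : Measurable X) {c : ℝ}
    (hc : ∀ ω ω', |X ω - X ω'| ≤ c) (t : ℝ) :
    Integrable (fun ω => Real.exp (t * X ω)) P ∧
    ∫ ω, Real.exp (t * X ω) ∂P ≤ Real.exp (t * ∫ ω, X ω ∂P + t ^ 2 * c ^ 2 / 8) := by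
  obtain ⟨ω₀⟩ : Nonempty Ω := nonempty_of_isProbabilityMeasure P
  have hbdd : BddBelow (Set.range X) := ⟨X ω₀ - c, by
    rintro _ ⟨ω, rfl⟩; linarith [(abs_le.1 (hc ω ω₀)).1]⟩
  set a := sInf (Set.range X) with ha
  have hmem : ∀ ω, X ω ∈ Set.Icc a (a + c) := fun ω => by
    refine ⟨csInf_le hbdd ⟨ω, rfl⟩, ?_⟩
    have : X ω - c ≤ a := le_csInf ⟨_, ω₀, rfl⟩ (by
      rintro _ ⟨ω', rfl⟩; linarith [(abs_le.1 (hc ω ω')).2])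
    linarith
  have h := hasSubgaussianMGF_of_mem_Icc (μ := P) hX.aemeasurable (ae_of_all _ hmem)
  have h1 := h.mgf_le t
  have h2 := h.integrable_exp_mul t
  have heq : ∀ ω, Real.exp (t * X ω)
      = Real.exp (t * ∫ ω, X ω ∂P) * Real.exp (t * (X ω - ∫ ω, X ω ∂P)) := fun ω => by
    rw [← Real.exp_add]; ring_nf
  simp only [heq]
  refine ⟨h2.const_mul _, ?_⟩
  rw [integral_const_mul, Real.exp_add]
  gcongr
  refine h1.trans (Real.exp_le_exp.2 (le_of_eq ?_))
  simp
  rw [div_pow, sq_abs]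
  ring

variable {E : Type*} [NormedAddCommGroup E]

theorem integrable_of_oscillation_le {ξ : Ω → E} (hξ : StronglyMeasurable ξ) {c : ℝ}
    (hc : ∀ ω ω', ‖ξ ω - ξ ω'‖ ≤ c) : Integrable ξ P := by
  obtain ⟨ω₀⟩ : Nonempty Ω := nonempty_of_isProbabilityMeasure P
  refine Integrable.of_bound hξ.aestronglyMeasurable (‖ξ ω₀‖ + c) (ae_of_all _ fun ω => ?_)
  calc ‖ξ ω‖ = ‖ξ ω₀ + (ξ ω - ξ ω₀)‖ := by congr 1; abel
    _ ≤ _ := (norm_add_le _ _).trans (by gcongr; exact hc _ _)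

theorem integrable_norm_add_pi_sum {ξ : Ω → E} (hi : Integrable ξ P)
    (n : ℕ) (s : E) :
    Integrable (fun w => ‖s + ∑ i, ξ (w i)‖) (Measure.pi fun _ : Fin n => P) := by
  refine ((integrable_const s).add (integrable_finsetSum _ fun i _ => ?_)).norm
  exact (measurePreserving_eval (fun _ : Fin n => P) i).integrable_comp_of_integrable hi

theorem integral_norm_pi_succ {ξ : Ω → E} (hi : Integrable ξ P)
    (n : ℕ) (s : E) :
    ∫ w, ‖s + ∑ i, ξ (w i)‖ ∂(Measure.pi fun _ : Fin (n + 1) => P)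
      = ∫ x, ∫ w, ‖s + ξ x + ∑ i, ξ (w i)‖ ∂(Measure.pi fun _ : Fin n => P) ∂P := by
  have h := (measurePreserving_piFinSuccAbove (fun _ : Fin (n + 1) => P) 0).symm
  have hI := (h.integrable_comp_emb (MeasurableEquiv.measurableEmbedding _)).2
    (integrable_norm_add_pi_sum P hi (n + 1) s)
  rw [← h.integral_comp']
  rw [integral_prod _ (by exact hI)]
  simp [MeasurableEquiv.piFinSuccAbove_symm_apply, Fin.insertNthEquiv, Fin.sum_univ_succ, add_assoc]

/-- Bounds the oscillation of the Doob martingale of the norm: revealing one summand changes the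
conditional mean by no more than the oscillation of that summand. -/
theorem lipschitz_integral_norm {ξ : Ω → E} (hi : Integrable ξ P)
    (n : ℕ) (s s' : E) :
    |∫ w, ‖s + ∑ i, ξ (w i)‖ ∂(Measure.pi fun _ : Fin n => P)
      - ∫ w, ‖s' + ∑ i, ξ (w i)‖ ∂(Measure.pi fun _ : Fin n => P)| ≤ ‖s - s'‖ := by
  rw [← integral_sub (integrable_norm_add_pi_sum P hi n s)
    (integrable_norm_add_pi_sum P hi n s')]
  rw [← Real.norm_eq_abs]
  refine (norm_integral_le_of_norm_le_const (C := ‖s - s'‖) (ae_of_all _ fun w => ?_)).trans ?_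
  · rw [Real.norm_eq_abs]
    refine (abs_norm_sub_norm_le _ _).trans (le_of_eq ?_)
    congr 1; abel
  · simp

variable [InnerProductSpace ℝ E] [CompleteSpace E]

theorem integral_norm_pi_sum_le {ξ : Ω → E} (hξ : StronglyMeasurable ξ) {c : ℝ}
    (hc : ∀ ω ω', ‖ξ ω - ξ ω'‖ ≤ c) (hmean : ∫ ω, ξ ω ∂P = 0) {v : ℝ} (hv : 0 ≤ v)
    (hvar : ∫ ω, ‖ξ ω‖ ^ 2 ∂P ≤ v) (n : ℕ) :
    ∫ w, ‖∑ i, ξ (w i)‖ ∂(Measure.pi fun _ : Fin n => P) ≤ √(n * v) := by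
  have hi := integrable_of_oscillation_le P hξ hc
  have hi2 : Integrable (fun ω => ‖ξ ω‖ ^ 2) P := by
    obtain ⟨ω₀⟩ : Nonempty Ω := nonempty_of_isProbabilityMeasure P
    refine Integrable.of_bound (hξ.norm.pow 2).aestronglyMeasurable ((‖ξ ω₀‖ + c) ^ 2)
      (ae_of_all _ fun ω => ?_)
    rw [Real.norm_of_nonneg (by positivity)]
    gcongr
    calc ‖ξ ω‖ = ‖ξ ω₀ + (ξ ω - ξ ω₀)‖ := by congr 1; abel
      _ ≤ _ := (norm_add_le _ _).trans (by gcongr; exact hc _ _)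
  -- For centred increments the cross term integrates to zero, so each remaining draw adds at most
  -- `v` to the squared norm.
  have key := lintegral_pi_sum_le P hξ (fun k s => ENNReal.ofReal (‖s‖ ^ 2 + k * v))
    (ENNReal.continuous_ofReal.comp (by fun_prop)) (by
      intro k s
      have hI1 : Integrable (fun ω => ‖s‖ ^ 2 + 2 * inner ℝ s (ξ ω)) P :=
        (integrable_const _).add ((hi.const_inner s).const_mul 2)
      have hI : Integrable (fun ω => ‖s + ξ ω‖ ^ 2 + k * v) P := by
        simp only [norm_add_sq_real]
        exact (hI1.add hi2).add (integrable_const _)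
      rw [← ofReal_integral_eq_lintegral_ofReal hI (ae_of_all _ fun ω => by positivity)]
      apply ENNReal.ofReal_le_ofReal
      simp only [norm_add_sq_real]
      rw [integral_add (by exact hI1.add hi2) (integrable_const _), integral_add hI1 hi2,
        integral_add (integrable_const _) ((hi.const_inner s).const_mul 2), integral_const_mul,
        integral_inner hi, hmean]
      simp
      linarith) n 0
  have hm := (stronglyMeasurable_pi_sum hξ n).norm
  have hL2 : MemLp (fun w : Fin n → Ω => ‖∑ i, ξ (w i)‖) 2 (Measure.pi fun _ : Fin n => P) := by
    rw [memLp_two_iff_integrable_sq hm.aestronglyMeasurable]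
    refine ⟨(hm.pow 2).aestronglyMeasurable, ?_⟩
    rw [hasFiniteIntegral_iff_ofReal (ae_of_all _ fun ω => by positivity)]
    refine lt_of_le_of_lt ?_ (ENNReal.ofReal_lt_top (r := n * v))
    simpa using key
  have hle : ∫ w, ‖∑ i, ξ (w i)‖ ^ 2 ∂(Measure.pi fun _ : Fin n => P) ≤ n * v := by
    refine (ENNReal.ofReal_le_ofReal_iff (by positivity)).1 ?_
    rw [ofReal_integral_eq_lintegral_ofReal hL2.integrable_sq (ae_of_all _ fun ω => by positivity)]
    simpa using key
  refine Real.le_sqrt_of_sq_le ?_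
  -- Nonnegativity of the variance plays the role of Jensen's inequality, passing from the second
  -- moment to the mean of the norm.
  have hvn := variance_nonneg (fun w : Fin n → Ω => ‖∑ i, ξ (w i)‖) (Measure.pi fun _ : Fin n => P)
  rw [variance_eq_sub hL2] at hvn
  simp only [Pi.pow_apply] at hvn
  linarith

/-- A bounded differences inequality for the norm of a sum of i.i.d. centred vectors. -/
theorem measure_norm_sum_gt_le_of_oscillation_le {ξ : Ω → E} (hξ : StronglyMeasurable ξ) {c : ℝ}
    (hc : ∀ ω ω', ‖ξ ω - ξ ω'‖ ≤ c) (hmean : ∫ ω, ξ ω ∂P = 0) {v : ℝ} (hv : 0 ≤ v)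
    (hvar : ∫ ω, ‖ξ ω‖ ^ 2 ∂P ≤ v) {n : ℕ} (hn : 0 < n) {τ : ℝ} (hτ : 0 < τ) :
    (Measure.pi fun _ : Fin n => P) {w | √(n * v) + c * √(n * τ / 2) < ‖∑ i, ξ (w i)‖}
      ≤ ENNReal.ofReal (Real.exp (-τ)) := by
  obtain ⟨ω₀⟩ : Nonempty Ω := nonempty_of_isProbabilityMeasure P
  have hi := integrable_of_oscillation_le P hξ hc
  have hc0 : 0 ≤ c := (norm_nonneg _).trans (hc ω₀ ω₀)
  -- The exponent `t` chosen below divides by `c ^ 2`; for `c = 0` the vector is constant and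
  -- centred, hence zero.
  rcases hc0.eq_or_lt with hc1 | hc1
  · have hconst : ∀ ω, ξ ω = ξ ω₀ := fun ω => by
      have := hc ω ω₀
      rw [← hc1] at this
      exact sub_eq_zero.1 (norm_le_zero_iff.1 this)
    have h0 : ξ ω₀ = 0 := by
      rw [← hmean]; simp [hconst]
    have : {w : Fin n → Ω | √(n * v) + c * √(n * τ / 2) < ‖∑ i, ξ (w i)‖} = ∅ := by
      ext w
      simpa [hconst, h0, ← hc1] using mul_nonneg (Real.sqrt_nonneg n) (Real.sqrt_nonneg v)
    rw [this]; simp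
  have hn' : (0 : ℝ) < n := Nat.cast_pos.2 hn
  set r := c * √(n * τ / 2) with hr
  have hrpos : 0 < r := by positivity
  have hr2 : r ^ 2 = c ^ 2 * (n * τ / 2) := by
    rw [hr, mul_pow, Real.sq_sqrt (by positivity)]
  -- The minimizer of `n t² c² / 8 - t r`. With this `r` one has `t r = 2τ` and `n t² c² / 8 = τ`,
  -- so the final exponent is `-τ`.
  set t := 4 * r / (n * c ^ 2) with ht
  have htpos : 0 < t := by positivity
  -- The conditional mean of the norm given the partial sum `s`, with `k` draws remaining;
  -- Hoeffding's lemma is applied to each of its increments.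
  set G : ℕ → E → ℝ := fun k s => ∫ w, ‖s + ∑ i, ξ (w i)‖ ∂(Measure.pi fun _ : Fin k => P) with hG
  have key := lintegral_pi_sum_le P hξ
    (fun k s => ENNReal.ofReal (Real.exp (t * G k s + k * (t ^ 2 * c ^ 2 / 8))))
    (ENNReal.continuous_ofReal.comp (by simp only [hG]; simp; fun_prop)) (by
      intro k s
      have hX : Measurable fun ω => G k (s + ξ ω) := by
        have hGc : Continuous (G k) := by
          refine LipschitzWith.continuous (K := 1) (LipschitzWith.of_dist_le_mul fun a b => ?_)
          simpa [dist_eq_norm] using lipschitz_integral_norm P hi k a b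
        exact (hGc.comp_stronglyMeasurable (stronglyMeasurable_const.add hξ)).measurable
      obtain ⟨h1, h2⟩ := integral_exp_le_of_oscillation_le P hX (c := c) (fun ω ω' => by
        refine (lipschitz_integral_norm P hi k _ _).trans (le_trans (le_of_eq ?_) (hc ω ω'))
        congr 1; abel) t
      simp only [Real.exp_add]
      rw [← ofReal_integral_eq_lintegral_ofReal (h1.mul_const _)
        (ae_of_all _ fun ω => by positivity)]
      apply ENNReal.ofReal_le_ofReal
      rw [integral_mul_const]
      have h3 : ∫ ω, G k (s + ξ ω) ∂P = G (k + 1) s := (integral_norm_pi_succ P hi k s).symm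
      rw [h3] at h2
      refine (mul_le_mul_of_nonneg_right h2 (by positivity)).trans (le_of_eq ?_)
      rw [← Real.exp_add, ← Real.exp_add]
      push_cast
      ring_nf) n 0
  have hG0 : G n 0 ≤ √(n * v) := by
    simpa [hG] using integral_norm_pi_sum_le P hξ hc hmean hv hvar n
  have hmark := mul_meas_ge_le_lintegral₀ (μ := Measure.pi fun _ : Fin n => P)
    (f := fun w => ENNReal.ofReal (Real.exp (t * ‖∑ i, ξ (w i)‖)))
    ((Real.continuous_exp.comp_stronglyMeasurable
      ((stronglyMeasurable_pi_sum hξ n).norm.const_mul t)).measurable.ennreal_ofReal.aemeasurable)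
    (ENNReal.ofReal (Real.exp (t * (√(n * v) + r))))
  have hsub : {w : Fin n → Ω | √(n * v) + r < ‖∑ i, ξ (w i)‖} ⊆
      {w | ENNReal.ofReal (Real.exp (t * (√(n * v) + r)))
        ≤ ENNReal.ofReal (Real.exp (t * ‖∑ i, ξ (w i)‖))} := by
    intro w hw
    simp only [Set.mem_ofPred_eq] at hw ⊢
    gcongr
  refine (measure_mono hsub).trans ?_
  have key2 : ∫⁻ w, ENNReal.ofReal (Real.exp (t * ‖∑ i, ξ (w i)‖)) ∂(Measure.pi fun _ : Fin n => P)
      ≤ ENNReal.ofReal (Real.exp (t * √(n * v) + n * (t ^ 2 * c ^ 2 / 8))) := by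
    refine le_trans (le_of_eq ?_) (key.trans (ENNReal.ofReal_le_ofReal (Real.exp_le_exp.2 (by
      gcongr))))
    simp [hG]
  have h2 := hmark.trans key2
  rw [mul_comm, ← ENNReal.le_div_iff_mul_le (Or.inl (by simpa using Real.exp_pos _))
    (Or.inl ENNReal.ofReal_ne_top), ← ENNReal.ofReal_div_of_pos (Real.exp_pos _),
    ← Real.exp_sub] at h2
  refine h2.trans (ENNReal.ofReal_le_ofReal (Real.exp_le_exp.2 (le_of_eq ?_)))
  have e1 : t * r = 2 * τ := by
    rw [ht, div_mul_eq_mul_div, mul_assoc, ← sq, hr2]; field_simp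
    ring
  have e2 : n * (t ^ 2 * c ^ 2 / 8) = τ := by
    have : n * (t ^ 2 * c ^ 2 / 8) = (t * r) / 2 := by
      rw [ht]; field_simp; ring
    rw [this, e1]; ring
  rw [mul_add, e1, e2]; ring

end Hoeffding

/-! ### Positive operators on a real Hilbert space -/

section PositiveOperators

open Filter Topology

variable {E : Type*} [NormedAddCommGroup E] [InnerProductSpace ℝ E]

section NotComplete

variable {A : E →L[ℝ] E}

theorem inner_apply_self_nonneg (hA : A.IsPositive) (u : E) : 0 ≤ inner ℝ (A u) u :=
  hA.inner_nonneg_left u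

theorem inner_apply_comm (hA : A.IsPositive) (u v : E) : inner ℝ (A u) v = inner ℝ (A v) u := by
  rw [hA.inner_left_eq_inner_right, real_inner_comm]

theorem inner_apply_add_self (hA : A.IsPositive) (u v : E) :
    inner ℝ (A (u + v)) (u + v)
      = inner ℝ (A u) u + 2 * inner ℝ (A u) v + inner ℝ (A v) v := by
  rw [map_add, inner_add_left, inner_add_right, inner_add_right, inner_apply_comm hA v u]
  ring

/-- Cauchy–Schwarz for the possibly degenerate form `⟪A u, v⟫`, from the discriminant of `t ↦ ⟪A (u
+ t v), u + t v⟫`. -/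
theorem inner_apply_sq_le (hA : A.IsPositive) (u v : E) :
    inner ℝ (A u) v ^ 2 ≤ inner ℝ (A u) u * inner ℝ (A v) v := by
  have h : ∀ t : ℝ, 0 ≤ inner ℝ (A v) v * (t * t) + 2 * inner ℝ (A u) v * t
      + inner ℝ (A u) u := fun t => by
    have := inner_apply_self_nonneg hA (u + t • v)
    rw [inner_apply_add_self hA] at this
    simp only [map_smul, inner_smul_left, inner_smul_right, RCLike.conj_to_real] at this
    linarith
  have := discrim_le_zero h
  rw [discrim] at this
  linarith

theorem norm_apply_le_of_inner_le (hA : A.IsPositive) {c : ℝ} (hc : 0 ≤ c)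
    (h : ∀ u, inner ℝ (A u) u ≤ c * ‖u‖ ^ 2) (u : E) : ‖A u‖ ≤ c * ‖u‖ := by
  have h1 := inner_apply_sq_le hA u (A u)
  rw [real_inner_self_eq_norm_sq] at h1
  have h2 := h u
  have h3 := h (A u)
  have h4 := inner_apply_self_nonneg hA u
  rcases eq_or_lt_of_le (norm_nonneg (A u)) with h0 | h0
  · rw [← h0]; positivity
  have h7 := inner_apply_self_nonneg hA (A u)
  have h5 : ‖A u‖ ^ 2 * ‖A u‖ ^ 2 ≤ (c * ‖u‖) ^ 2 * ‖A u‖ ^ 2 := by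
    calc ‖A u‖ ^ 2 * ‖A u‖ ^ 2 = (‖A u‖ ^ 2) ^ 2 := by ring
      _ ≤ _ := h1
      _ ≤ (c * ‖u‖ ^ 2) * (c * ‖A u‖ ^ 2) := by gcongr
      _ = _ := by ring
  have h6 := le_of_mul_le_mul_right h5 (by positivity)
  exact (sq_le_sq₀ h0.le (by positivity)).1 h6

theorem opNorm_le_of_inner_le (hA : A.IsPositive) {c : ℝ} (hc : 0 ≤ c)
    (h : ∀ u, inner ℝ (A u) u ≤ c * ‖u‖ ^ 2) : ‖A‖ ≤ c :=
  A.opNorm_le_bound hc (norm_apply_le_of_inner_le hA hc h)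

variable {g : E} {k : ℝ} {J : E → ℝ}

/-- Moving from `f₀` along the residual `d = A f₀ - g` changes `J` by `t² ⟪A d, d⟫ + 2t ‖d‖²`; a
quadratic without constant term is nonnegative for all `t` only if its linear coefficient vanishes.
-/
theorem apply_eq_of_isMin (hA : A.IsPositive)
    (hJ : ∀ f, J f = inner ℝ (A f) f - 2 * inner ℝ g f + k) {f₀ : E} (hmin : ∀ f, J f₀ ≤ J f) :
    A f₀ = g := by
  set d := A f₀ - g with hd
  have h : ∀ t : ℝ, 0 ≤ inner ℝ (A d) d * (t * t) + 2 * ‖d‖ ^ 2 * t + 0 := fun t => by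
    have h1 := hmin (f₀ + t • d)
    rw [hJ, hJ, inner_apply_add_self hA, inner_add_right] at h1
    simp only [map_smul, inner_smul_left, inner_smul_right, RCLike.conj_to_real] at h1
    have h2 : ‖d‖ ^ 2 = inner ℝ (A f₀) d - inner ℝ g d := by
      rw [← inner_sub_left, ← hd, real_inner_self_eq_norm_sq]
    rw [h2]
    linarith
  have := discrim_le_zero h
  rw [discrim] at this
  have h3 : (‖d‖ ^ 2) ^ 2 = 0 := by nlinarith [sq_nonneg (‖d‖ ^ 2)]
  have : ‖d‖ = 0 := by simpa using h3
  exact sub_eq_zero.1 (norm_eq_zero.1 this)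

theorem sub_eq_inner_of_isMin (hA : A.IsPositive)
    (hJ : ∀ f, J f = inner ℝ (A f) f - 2 * inner ℝ g f + k) {f₀ : E} (hmin : ∀ f, J f₀ ≤ J f)
    (f : E) : J f - J f₀ = inner ℝ (A (f - f₀)) (f - f₀) := by
  obtain ⟨d, rfl⟩ : ∃ d, f = f₀ + d := ⟨f - f₀, by abel⟩
  rw [hJ, hJ, inner_apply_add_self hA, add_sub_cancel_left, inner_add_right,
    apply_eq_of_isMin hA hJ hmin]
  ring

/-- Distinct basis vectors are at distance `√2 ≥ 1`, so balls of radius 1/2 around them are disjoint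
open sets in a separable space. -/
theorem countable_of_hilbertBasis [TopologicalSpace.SeparableSpace E] {ι : Type*}
    (b : HilbertBasis ι ℝ E) : Countable ι := by
  rw [← Set.countable_univ_iff]
  refine Set.PairwiseDisjoint.countable_of_isOpen (s := fun i => Metric.ball (b i) (1 / 2))
    (fun i _ j _ hij => Metric.ball_disjoint_ball ?_) (fun _ _ => Metric.isOpen_ball)
    (fun i _ => ⟨b i, Metric.mem_ball_self (by norm_num)⟩)
  have h : ‖b i - b j‖ ^ 2 = 2 := by
    rw [norm_sub_sq_real, b.orthonormal.1 i, b.orthonormal.1 j, b.orthonormal.2 hij]; norm_num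
  rw [dist_eq_norm]
  nlinarith [norm_nonneg (b i - b j)]

end NotComplete

variable [CompleteSpace E]

theorem isPositive_iff_real {A : E →L[ℝ] E} :
    A.IsPositive ↔ IsSelfAdjoint A ∧ ∀ x, 0 ≤ inner ℝ (A x) x := by
  rw [ContinuousLinearMap.isPositive_def']
  simp [ContinuousLinearMap.reApplyInnerSelf]

/-- With `A = 1 - R`, a root `1 - Z` amounts to the fixed point equation `Z = (R + Z²) / 2`. The
iteration from 0 is dominated by the scalar iteration `r ↦ (1 + r²) / 2`, whose increments telescope
below 1; hence it converges, and its limit is self-adjoint of norm at most 1. -/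
theorem exists_sqrt_of_norm_le_one {A : E →L[ℝ] E} (hA : A.IsPositive) (hA1 : ‖A‖ ≤ 1) :
    ∃ S : E →L[ℝ] E, S.IsPositive ∧ S ∘L S = A := by
  have hle : ∀ u, inner ℝ (A u) u ≤ ‖u‖ ^ 2 := fun u => by
    refine (real_inner_le_norm _ _).trans ?_
    rw [sq]
    gcongr
    exact (A.le_of_opNorm_le hA1 u).trans (by simp)
  set R : E →L[ℝ] E := 1 - A with hR
  have hRpos : R.IsPositive := by
    rw [isPositive_iff_real]
    refine ⟨(IsSelfAdjoint.one _).sub hA.isSelfAdjoint, fun u => ?_⟩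
    have := hle u
    simp only [hR, sub_apply, one_apply_eq_self, inner_sub_left,
      real_inner_self_eq_norm_sq]
    linarith
  have hR1 : ‖R‖ ≤ 1 := opNorm_le_of_inner_le hRpos zero_le_one fun u => by
    have := inner_apply_self_nonneg hA u
    simp only [hR, sub_apply, one_apply_eq_self, inner_sub_left,
      real_inner_self_eq_norm_sq]
    linarith
  obtain ⟨Y, hY0, hY⟩ : ∃ Y : ℕ → (E →L[ℝ] E), Y 0 = 0 ∧
      ∀ n, Y (n + 1) = (1 / 2 : ℝ) • (R + Y n * Y n) :=
    ⟨fun n => Nat.rec 0 (fun _ Z => (1 / 2 : ℝ) • (R + Z * Z)) n, rfl, fun _ => rfl⟩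
  obtain ⟨r, hr0, hr⟩ : ∃ r : ℕ → ℝ, r 0 = 0 ∧ ∀ n, r (n + 1) = (1 / 2 : ℝ) * (1 + r n * r n) :=
    ⟨fun n => Nat.rec 0 (fun _ z => (1 / 2 : ℝ) * (1 + z * z)) n, rfl, fun _ => rfl⟩
  have hr01 : ∀ n, 0 ≤ r n ∧ r n ≤ 1 := by
    intro n
    induction n with
    | zero => simp [hr0]
    | succ n ih => rw [hr]; constructor <;> nlinarith
  have hYr : ∀ n, ‖Y n‖ ≤ r n := by
    intro n
    induction n with
    | zero => simp [hY0, hr0]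
    | succ n ih =>
      rw [hY, hr, norm_smul, Real.norm_of_nonneg (by norm_num)]
      gcongr
      refine (norm_add_le _ _).trans (add_le_add hR1 ((norm_mul_le _ _).trans ?_))
      gcongr
      exact (hr01 n).1
  have hd : ∀ n, ‖Y (n + 1) - Y n‖ ≤ r (n + 1) - r n := by
    intro n
    induction n with
    | zero =>
      rw [hY0, hr0, sub_zero, sub_zero]
      exact hYr 1
    | succ n ih =>
      have e : Y (n + 1 + 1) - Y (n + 1)
          = (1 / 2 : ℝ) • (Y (n + 1) * (Y (n + 1) - Y n) + (Y (n + 1) - Y n) * Y n) := by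
        have e1 : Y (n + 1 + 1) - Y (n + 1)
            = (1 / 2 : ℝ) • (R + Y (n + 1) * Y (n + 1)) - (1 / 2 : ℝ) • (R + Y n * Y n) := by
          rw [hY (n + 1), hY n]
        rw [e1, ← smul_sub]
        generalize Y (n + 1) = W
        congr 1
        noncomm_ring
      rw [e, norm_smul, Real.norm_of_nonneg (by norm_num), hr (n + 1)]
      have h1 : ‖Y (n + 1) * (Y (n + 1) - Y n)‖ ≤ r (n + 1) * (r (n + 1) - r n) :=
        (norm_mul_le _ _).trans (mul_le_mul (hYr _) ih (norm_nonneg _) (hr01 _).1)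
      have h2 : ‖(Y (n + 1) - Y n) * Y n‖ ≤ (r (n + 1) - r n) * r n :=
        (norm_mul_le _ _).trans (mul_le_mul ih (hYr _) (norm_nonneg _)
          ((norm_nonneg _).trans ih))
      have h3 := norm_add_le (Y (n + 1) * (Y (n + 1) - Y n)) ((Y (n + 1) - Y n) * Y n)
      have h4 : r (n + 1) = 1 / 2 * (1 + r n * r n) := hr n
      nlinarith
  have hsum : Summable fun n => r (n + 1) - r n := by
    refine summable_of_sum_range_le (c := 1) (fun n => (norm_nonneg _).trans (hd n)) fun n => ?_
    rw [Finset.sum_range_sub]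
    linarith [(hr01 n).2]
  obtain ⟨Z, hZ⟩ := cauchySeq_tendsto_of_complete (cauchySeq_of_dist_le_of_summable
    (f := Y) _ (fun n => by rw [dist_comm, dist_eq_norm]; exact hd n) hsum)
  have hZeq : Z = (1 / 2 : ℝ) • (R + Z * Z) :=
    tendsto_nhds_unique ((tendsto_add_atTop_iff_nat 1).2 hZ)
      ((((hZ.mul hZ).const_add R).const_smul (1 / 2 : ℝ)).congr fun n => (hY n).symm)
  have hZ1 : ‖Z‖ ≤ 1 := le_of_tendsto hZ.norm
    (Eventually.of_forall fun n => (hYr n).trans (hr01 n).2)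
  have hYsa : ∀ n, IsSelfAdjoint (Y n) := by
    intro n
    induction n with
    | zero => rw [hY0]; exact IsSelfAdjoint.zero _
    | succ n ih =>
      rw [hY]
      refine IsSelfAdjoint.smul (IsSelfAdjoint.all _) (hRpos.isSelfAdjoint.add ?_)
      simpa [sq] using ih.pow 2
  have hZsa : IsSelfAdjoint Z :=
    (isClosed_eq continuous_star continuous_id).mem_of_tendsto hZ (Eventually.of_forall hYsa)
  refine ⟨1 - Z, isPositive_iff_real.2 ⟨(IsSelfAdjoint.one _).sub hZsa, fun u => ?_⟩, ?_⟩
  · simp only [sub_apply, one_apply_eq_self, inner_sub_left,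
      real_inner_self_eq_norm_sq, sub_nonneg]
    refine (real_inner_le_norm _ _).trans ?_
    rw [sq]
    gcongr
    exact (Z.le_of_opNorm_le hZ1 u).trans (by simp)
  · change (1 - Z) * (1 - Z) = A
    have h2 : (2 : ℝ) • Z = R + Z * Z := by
      conv_lhs => rw [hZeq]
      rw [smul_smul]; norm_num
    rw [two_smul, hR] at h2
    have : (1 - Z) * (1 - Z) = 1 - (Z + Z) + Z * Z := by noncomm_ring
    rw [this, h2]
    abel

theorem exists_sqrt_of_isPositive {A : E →L[ℝ] E} (hA : A.IsPositive) :
    ∃ S : E →L[ℝ] E, S.IsPositive ∧ S ∘L S = A := by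
  rcases eq_or_ne A 0 with rfl | h0
  · exact ⟨0, ContinuousLinearMap.isPositive_zero, by simp⟩
  have hn : 0 < ‖A‖ := norm_pos_iff.2 h0
  obtain ⟨S, hS, hSS⟩ := exists_sqrt_of_norm_le_one (A := ‖A‖⁻¹ • A)
    (hA.smul_of_nonneg (by positivity)) (by
      rw [norm_smul, norm_inv, norm_norm, inv_mul_cancel₀ hn.ne'])
  refine ⟨√‖A‖ • S, hS.smul_of_nonneg (Real.sqrt_nonneg _), ?_⟩
  rw [ContinuousLinearMap.smul_comp, ContinuousLinearMap.comp_smul, smul_smul,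
    Real.mul_self_sqrt hn.le, hSS, smul_smul, mul_inv_cancel₀ hn.ne', one_smul]

/-- Existence of a root suffices: `opSqrt` enters later only through these two properties, so
uniqueness plays no role. -/
theorem opSqrt_spec {A : E →L[ℝ] E} (hA : A.IsPositive) :
    (opSqrt A).IsPositive ∧ opSqrt A ∘L opSqrt A = A :=
  Classical.epsilon_spec (p := fun S : E →L[ℝ] E => S.IsPositive ∧ S ∘L S = A)
    (exists_sqrt_of_isPositive hA)

theorem opSqrt_opSqrt_apply {A : E →L[ℝ] E} (hA : A.IsPositive) (u : E) :
    opSqrt A (opSqrt A u) = A u :=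
  congrArg (fun B : E →L[ℝ] E => B u) (opSqrt_spec hA).2

theorem inner_opSqrt_opSqrt {A : E →L[ℝ] E} (hA : A.IsPositive) (u v : E) :
    inner ℝ (opSqrt A u) (opSqrt A v) = inner ℝ (A u) v := by
  rw [← opSqrt_opSqrt_apply hA u, (opSqrt_spec hA).1.inner_left_eq_inner_right (opSqrt A u) v]

theorem norm_opSqrt_sq {A : E →L[ℝ] E} (hA : A.IsPositive) (u : E) :
    ‖opSqrt A u‖ ^ 2 = inner ℝ (A u) u := by
  rw [← inner_opSqrt_opSqrt hA, real_inner_self_eq_norm_sq]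

/-! ### The resolvent of a positive operator. -/

section Resolvent

variable {A : E →L[ℝ] E} {lam : ℝ}

theorem isUnit_add_smul_id (hA : A.IsPositive) (hlam : 0 < lam) :
    IsUnit (A + lam • ContinuousLinearMap.id ℝ E) := by
  refine ContinuousLinearMap.isUnit_of_forall_le_norm_inner_map _ (c := ⟨lam, hlam.le⟩) hlam
    fun u => ?_
  have := inner_apply_self_nonneg hA u
  rw [Real.norm_eq_abs]
  refine le_trans ?_ (le_abs_self _)
  simp only [add_apply, smul_apply,
    ContinuousLinearMap.id_apply, inner_add_left, inner_smul_left, real_inner_self_eq_norm_sq,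
    RCLike.conj_to_real]
  change ‖u‖ ^ 2 * lam ≤ _
  linarith

theorem apply_resolv_add (hA : A.IsPositive) (hlam : 0 < lam) (u : E) :
    A (resolv A lam u) + lam • resolv A lam u = u := by
  have := Ring.mul_inverse_cancel _ (isUnit_add_smul_id hA hlam)
  simpa [resolv] using congrArg (fun B : E →L[ℝ] E => B u) this

theorem resolv_apply_add (hA : A.IsPositive) (hlam : 0 < lam) (u : E) :
    resolv A lam (A u + lam • u) = u := by
  have := Ring.inverse_mul_cancel _ (isUnit_add_smul_id hA hlam)
  simpa [resolv] using congrArg (fun B : E →L[ℝ] E => B u) this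

theorem resolv_isPositive (hA : A.IsPositive) (hlam : 0 < lam) : (resolv A lam).IsPositive := by
  rw [isPositive_iff_real]
  constructor
  · rw [ContinuousLinearMap.isSelfAdjoint_iff_isSymmetric]
    intro u v
    change inner ℝ (resolv A lam u) v = inner ℝ u (resolv A lam v)
    conv_lhs => rw [← apply_resolv_add hA hlam v]
    conv_rhs => rw [← apply_resolv_add hA hlam u]
    rw [inner_add_right, inner_add_left, hA.inner_left_eq_inner_right, inner_smul_left,
      inner_smul_right, RCLike.conj_to_real]
  · intro u
    have h : inner ℝ (resolv A lam u) u
        = inner ℝ (resolv A lam u) (A (resolv A lam u) + lam • resolv A lam u) := by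
      rw [apply_resolv_add hA hlam]
    rw [h, real_inner_comm, inner_add_left, inner_smul_left, RCLike.conj_to_real]
    have := inner_apply_self_nonneg hA (resolv A lam u)
    have := mul_nonneg hlam.le (real_inner_self_nonneg (x := resolv A lam u))
    linarith

theorem inner_resolv_self_le (hA : A.IsPositive) (hlam : 0 < lam) (u : E) :
    inner ℝ (resolv A lam u) u ≤ ‖u‖ ^ 2 / lam := by
  rw [le_div_iff₀ hlam]
  set w := resolv A lam u with hw
  have h1 : ‖u‖ ^ 2 = ‖A w‖ ^ 2 + 2 * lam * inner ℝ (A w) w + lam ^ 2 * ‖w‖ ^ 2 := by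
    conv_lhs => rw [← apply_resolv_add hA hlam u]
    rw [norm_add_sq_real, norm_smul, mul_pow, Real.norm_eq_abs, sq_abs, inner_smul_right]
    ring
  have h2 : inner ℝ w u = inner ℝ (A w) w + lam * ‖w‖ ^ 2 := by
    conv_lhs => rw [← apply_resolv_add hA hlam u]
    rw [inner_add_right, inner_smul_right, real_inner_self_eq_norm_sq, real_inner_comm]
  rw [h1, h2]
  have := inner_apply_self_nonneg hA w
  nlinarith [sq_nonneg ‖A w‖, mul_nonneg hlam.le this]

end Resolvent

/-! ### Quadratic functionals -/

section Quadratic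

/-- Quadratic growth around `f₀` makes the minimizer unique, so the choice made by `argmin` must be
`f₀`. -/
theorem argmin_eq_of_forall_le {F : Type*} [NormedAddCommGroup F] {J : F → ℝ} {f₀ : F} {c : ℝ}
    (hc : 0 < c) (h : ∀ f, J f₀ + c * ‖f - f₀‖ ^ 2 ≤ J f) : argmin J = f₀ := by
  have hex : ∃ f, ∀ g, J f ≤ J g :=
    ⟨f₀, fun g => le_trans (le_add_of_nonneg_right (by positivity)) (h g)⟩
  have h1 : J (argmin J) ≤ J f₀ := Classical.epsilon_spec hex f₀
  have h2 := h (argmin J)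
  have h3 : c * ‖argmin J - f₀‖ ^ 2 ≤ 0 := by linarith
  have h4 : ‖argmin J - f₀‖ ^ 2 ≤ 0 := nonpos_of_mul_nonpos_right h3 hc
  exact sub_eq_zero.1 (norm_eq_zero.1 (pow_eq_zero_iff two_ne_zero |>.1
    (le_antisymm h4 (sq_nonneg _))))

variable {A : E →L[ℝ] E} {g : E} {k : ℝ} {J : E → ℝ}

theorem argmin_add_regularizer (hA : A.IsPositive)
    (hJ : ∀ f, J f = inner ℝ (A f) f - 2 * inner ℝ g f + k) {lam : ℝ} (hlam : 0 < lam) :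
    argmin (fun f => J f + lam * ‖f‖ ^ 2) = resolv A lam g := by
  refine argmin_eq_of_forall_le hlam fun f => ?_
  set f₀ := resolv A lam g with hf₀
  obtain ⟨d, rfl⟩ : ∃ d, f = f₀ + d := ⟨f - f₀, by abel⟩
  have h1 : inner ℝ (A f₀) d + lam * inner ℝ f₀ d = inner ℝ g d := by
    conv_rhs => rw [← apply_resolv_add hA hlam g]
    rw [inner_add_left, inner_smul_left, RCLike.conj_to_real]
  have h2 := inner_apply_self_nonneg hA d
  simp only [hJ, add_sub_cancel_left]
  rw [inner_apply_add_self hA, norm_add_sq_real, inner_add_right]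
  linarith

end Quadratic

end PositiveOperators

/-! ### Features of a real-valued reproducing kernel Hilbert space -/

section Features

open Filter Topology

variable {S : Type*} {F : Type*} [NormedAddCommGroup F] [InnerProductSpace ℝ F] [CompleteSpace F]
  [RKHS ℝ F S ℝ]

theorem inner_feature_left (t : S) (f : F) : inner ℝ (feature F t) f = f t := by
  simp [feature]

theorem inner_feature_right (t : S) (f : F) : inner ℝ f (feature F t) = f t := by
  rw [real_inner_comm, inner_feature_left]

theorem feature_apply (s t : S) : feature F t s = kerVal F s t := by
  simp [feature, kerVal, RKHS.kerFun_apply]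

theorem inner_feature_feature (s t : S) :
    inner ℝ (feature F s) (feature F t) = kerVal F s t := by
  rw [inner_feature_left, feature_apply]

theorem norm_feature_sq (t : S) : ‖feature F t‖ ^ 2 = kerVal F t t := by
  rw [← real_inner_self_eq_norm_sq, inner_feature_feature]

theorem norm_feature_sub_sq (s t : S) :
    ‖feature F s - feature F t‖ ^ 2 = kerVal F s s - 2 * kerVal F s t + kerVal F t t := by
  have h := norm_sub_sq_real (feature F s) (feature F t)
  rw [h, norm_feature_sq (F := F) s, norm_feature_sq (F := F) t, inner_feature_feature s t]

theorem norm_feature_le {B : ℝ} (hB : ∀ t : S, kerVal F t t ≤ B) (t : S) : ‖feature F t‖ ≤ √B :=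
  Real.le_sqrt_of_sq_le (by rw [norm_feature_sq]; exact hB t)

theorem pointOp_eq_rankOne (t : S) :
    pointOp F t = InnerProductSpace.rankOne ℝ (feature F t) (feature F t) := by
  ext1 f
  rw [InnerProductSpace.rankOne_apply, inner_feature_left]
  rfl

theorem pointOp_apply (t : S) (f : F) : pointOp F t f = f t • feature F t := rfl

theorem norm_pointOp (t : S) : ‖pointOp F t‖ = ‖feature F t‖ ^ 2 := by
  rw [pointOp_eq_rankOne, InnerProductSpace.norm_rankOne, sq]

theorem abs_rkhs_apply_le {b : ℝ} (hb : ∀ t : S, ‖feature F t‖ ≤ b) (f : F) (t : S) :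
    |f t| ≤ b * ‖f‖ := by
  rw [← inner_feature_left]
  exact (abs_real_inner_le_norm _ _).trans (by gcongr; exact hb t)

variable [TopologicalSpace S]

/-- The features have separable range, and their span is dense in the space. -/
theorem separableSpace_of_continuous_feature [TopologicalSpace.SeparableSpace S]
    (hφ : Continuous (feature F : S → F)) : TopologicalSpace.SeparableSpace F := by
  rw [← TopologicalSpace.isSeparable_univ_iff]
  have h1 : TopologicalSpace.IsSeparable
      ((Submodule.span ℝ (Set.range (feature F : S → F)) : Submodule ℝ F) : Set F) :=
    (TopologicalSpace.isSeparable_range hφ).span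
  refine h1.closure.mono fun f _ => ?_
  have h2 : f ∈ (Submodule.span ℝ {RKHS.kerFun F x v | (x : S) (v : ℝ)}).topologicalClosure := by
    rw [RKHS.kerFun_dense]; trivial
  refine closure_mono (Submodule.span_le.2 ?_) h2
  rintro _ ⟨x, v, rfl⟩
  have : RKHS.kerFun F x v = v • feature F x := by
    rw [feature, ← map_smul, smul_eq_mul, mul_one]
  rw [this]
  exact Submodule.smul_mem _ _ (Submodule.subset_span ⟨x, rfl⟩)

theorem continuous_feature_of_continuous_kerVal
    (h : Continuous fun p : S × S => kerVal F p.1 p.2) : Continuous (feature F : S → F) := by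
  rw [continuous_iff_continuousAt]
  intro t
  rw [ContinuousAt, tendsto_iff_norm_sub_tendsto_zero]
  have h1 : ∀ s, ‖feature F s - feature F t‖
      = √(kerVal F s s - 2 * kerVal F s t + kerVal F t t) := fun s => by
    rw [← norm_feature_sub_sq, Real.sqrt_sq (norm_nonneg _)]
  simp only [h1]
  generalize kerVal F = k at h
  have h2 : Continuous fun s => √(k s s - 2 * k s t + k t t) := by
    have e1 : Continuous fun s => k s s := h.comp (by fun_prop : Continuous fun s : S => (s, s))
    have e2 : Continuous fun s => k s t := h.comp (by fun_prop : Continuous fun s : S => (s, t))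
    fun_prop
  have h3 := h2.tendsto t
  have h4 : k t t - 2 * k t t + k t t = 0 := by ring
  rwa [h4, Real.sqrt_zero] at h3

theorem continuous_pointOp (hφ : Continuous (feature F : S → F)) :
    Continuous (pointOp F : S → F →L[ℝ] F) := by
  have h : (pointOp F : S → F →L[ℝ] F)
      = fun t => InnerProductSpace.rankOne ℝ (feature F t) (feature F t) :=
    funext pointOp_eq_rankOne
  rw [h]
  exact ((InnerProductSpace.rankOne ℝ).continuous.comp hφ).clm_apply hφ

theorem continuous_rkhs_apply (hφ : Continuous (feature F : S → F)) (f : F) : Continuous f := by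
  have h : ⇑f = fun t => inner ℝ (feature F t) f := funext fun t => (inner_feature_left t f).symm
  rw [h]
  exact hφ.inner continuous_const

end Features

/-! ### Second moment operators -/

section Population

variable {S : Type*} [TopologicalSpace S] [SecondCountableTopology S] [MeasurableSpace S]
  [OpensMeasurableSpace S]
  {F : Type*} [NormedAddCommGroup F] [InnerProductSpace ℝ F] [CompleteSpace F] [RKHS ℝ F S ℝ]
  (hφ : Continuous (feature F : S → F)) {b : ℝ} (hb : ∀ t : S, ‖feature F t‖ ≤ b)
  (μ : Measure S) [IsProbabilityMeasure μ]

include hφ hb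

theorem integrable_pointOp : Integrable (pointOp F : S → F →L[ℝ] F) μ :=
  Integrable.of_bound (continuous_pointOp hφ).aestronglyMeasurable (b ^ 2)
    (ae_of_all _ fun t => by rw [norm_pointOp]; gcongr; exact hb t)

theorem integral_pointOp_apply (u : F) :
    (∫ a, pointOp F a ∂μ) u = ∫ a, u a • feature F a ∂μ := by
  rw [ContinuousLinearMap.integral_apply (integrable_pointOp hφ hb μ)]
  rfl

theorem integrable_apply_smul_feature (u : F) : Integrable (fun a => u a • feature F a) μ :=
  (integrable_pointOp hφ hb μ).apply_continuousLinearMap u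

theorem inner_integral_pointOp (u v : F) :
    inner ℝ ((∫ a, pointOp F a ∂μ) u) v = ∫ a, u a * v a ∂μ := by
  rw [integral_pointOp_apply hφ hb, real_inner_comm,
    ← integral_inner (integrable_apply_smul_feature hφ hb μ u)]
  simp only [inner_smul_right, inner_feature_right]

theorem integral_pointOp_isPositive : (∫ a, pointOp F a ∂μ).IsPositive := by
  rw [isPositive_iff_real]
  refine ⟨?_, fun u => ?_⟩
  · rw [ContinuousLinearMap.isSelfAdjoint_iff_isSymmetric]
    intro u v
    change inner ℝ ((∫ a, pointOp F a ∂μ) u) v = inner ℝ u ((∫ a, pointOp F a ∂μ) v)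
    rw [real_inner_comm _ u, inner_integral_pointOp hφ hb, inner_integral_pointOp hφ hb]
    simp only [mul_comm]
  · rw [inner_integral_pointOp hφ hb]
    exact integral_nonneg fun a => mul_self_nonneg _

/-- Parseval's identity under the integral. Separability makes the basis countable, as the exchange
of sum and integral requires. -/
theorem opTrace_comp_integral_pointOp (V : F →L[ℝ] F) (hV : V.IsPositive)
    [TopologicalSpace.SeparableSpace F] :
    opTrace (V ∘L ∫ a, pointOp F a ∂μ) = ∫ a, inner ℝ (V (feature F a)) (feature F a) ∂μ := by
  unfold opTrace
  generalize hbas : (exists_hilbertBasis ℝ F).choose_spec.choose = e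
  have := countable_of_hilbertBasis e
  refine HasSum.tsum_eq ?_
  have hterm : ∀ i, inner ℝ ((V ∘L ∫ a, pointOp F a ∂μ) (e i)) (e i)
      = ∫ a, inner ℝ (feature F a) (e i) * inner ℝ (e i) (V (feature F a)) ∂μ := fun i => by
    rw [ContinuousLinearMap.comp_apply, hV.inner_left_eq_inner_right,
      inner_integral_pointOp hφ hb]
    refine integral_congr_ae (ae_of_all _ fun a => ?_)
    simp only
    rw [inner_feature_left, ← hV.inner_left_eq_inner_right, inner_feature_right]
  simp only [hterm]
  have hb0 : ∀ a : S, 0 ≤ b := fun a => (norm_nonneg _).trans (hb a)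
  have hsq : ∀ x : F, HasSum (fun i => inner ℝ x (e i) * inner ℝ x (e i)) (‖x‖ ^ 2) := fun x => by
    have := e.hasSum_inner_mul_inner x x
    simp only [real_inner_comm x] at this ⊢
    simpa [real_inner_self_eq_norm_sq, real_inner_comm] using this
  have hcV : Continuous fun a => V (feature F a) := V.continuous.comp hφ
  -- The bound `|p q| ≤ p² + q²` dominates the terms, and Parseval sums it to `‖φ‖² + ‖V φ‖²`, which
  -- is bounded.
  refine (hasSum_integral_of_dominated_convergence
    (bound := fun i a => (inner ℝ (feature F a) (e i) * inner ℝ (feature F a) (e i)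
      + inner ℝ (V (feature F a)) (e i) * inner ℝ (V (feature F a)) (e i)))
    (fun i => ?_) (fun i => ae_of_all _ fun a => ?_) (ae_of_all _ fun a => ?_) ?_
    (ae_of_all _ fun a => ?_))
  · exact ((hφ.inner continuous_const).mul (continuous_const.inner hcV)).aestronglyMeasurable
  · rw [Real.norm_eq_abs, real_inner_comm (V _), abs_le]
    set p := inner ℝ (feature F a) (e i)
    set q := inner ℝ (V (feature F a)) (e i)
    constructor <;> nlinarith [sq_nonneg (p + q), sq_nonneg (p - q), sq_nonneg p, sq_nonneg q]
  · exact ((hsq _).add (hsq _)).summable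
  · have : ∀ a, ∑' i, (inner ℝ (feature F a) (e i) * inner ℝ (feature F a) (e i)
      + inner ℝ (V (feature F a)) (e i) * inner ℝ (V (feature F a)) (e i))
      = ‖feature F a‖ ^ 2 + ‖V (feature F a)‖ ^ 2 := fun a => ((hsq _).add (hsq _)).tsum_eq
    simp only [this]
    refine Integrable.of_bound (by fun_prop) (b ^ 2 + (‖V‖ * b) ^ 2) (ae_of_all _ fun a => ?_)
    rw [Real.norm_of_nonneg (by positivity)]
    have := hb0 a
    gcongr
    · exact hb a
    · exact V.le_opNorm_of_le (hb a)
  · rw [← real_inner_comm (V _)]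
    exact e.hasSum_inner_mul_inner _ _

/-- Effective dimension as an expectation. -/
theorem opTrace_resolv_comp [TopologicalSpace.SeparableSpace F] {lam : ℝ} (hlam : 0 < lam) :
    opTrace (resolv (∫ a, pointOp F a ∂μ) lam ∘L ∫ a, pointOp F a ∂μ)
      = ∫ a, inner ℝ (resolv (∫ a, pointOp F a ∂μ) lam (feature F a)) (feature F a) ∂μ :=
  opTrace_comp_integral_pointOp hφ hb μ _
    (resolv_isPositive (integral_pointOp_isPositive hφ hb μ) hlam)

/-- Since `u a = ⟪R φ_a, (T + λ) u⟫` for the resolvent `R`, Cauchy–Schwarz and integration give `⟪T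
u, u⟫ ≤ n (⟪T u, u⟫ + λ ‖u‖²)`, where `n` is the integral. If `n < 1/2`, this forces `‖T‖ < λ`. The
bound lets the linear Bernstein term be absorbed into the effective dimension. -/
theorem half_le_integral_inner_resolv {lam : ℝ} (hlam : 0 < lam)
    (hle : lam ≤ ‖∫ a, pointOp F a ∂μ‖) :
    1 / 2 ≤ ∫ a, inner ℝ (resolv (∫ a, pointOp F a ∂μ) lam (feature F a)) (feature F a) ∂μ := by
  set T := ∫ a, pointOp F a ∂μ with hT
  have hTp : T.IsPositive := integral_pointOp_isPositive hφ hb μ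
  have hRp := resolv_isPositive hTp hlam
  set n := ∫ a, inner ℝ (resolv T lam (feature F a)) (feature F a) ∂μ with hn
  have hcR : Continuous fun a => resolv T lam (feature F a) := (resolv T lam).continuous.comp hφ
  have hint : Integrable (fun a => inner ℝ (resolv T lam (feature F a)) (feature F a)) μ := by
    refine Integrable.of_bound (hcR.inner hφ).aestronglyMeasurable (‖resolv T lam‖ * b * b)
      (ae_of_all _ fun a => ?_)
    have hb0 : 0 ≤ b := (norm_nonneg _).trans (hb a)
    exact (norm_inner_le_norm _ _).trans (mul_le_mul ((resolv T lam).le_opNorm_of_le (hb a)) (hb a)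
      (norm_nonneg _) (by positivity))
  have hn0 : 0 ≤ n := integral_nonneg fun a => inner_apply_self_nonneg hRp _
  have key : ∀ u : F, inner ℝ (T u) u ≤ n * (inner ℝ (T u) u + lam * ‖u‖ ^ 2) := fun u => by
    have h1 : ∀ a, u a * u a ≤ inner ℝ (resolv T lam (feature F a)) (feature F a)
        * (inner ℝ (T u) u + lam * ‖u‖ ^ 2) := fun a => by
      have := inner_apply_sq_le hRp (feature F a) (T u + lam • u)
      rw [hRp.inner_left_eq_inner_right, resolv_apply_add hTp hlam, inner_feature_left,
        inner_add_right, inner_smul_right, real_inner_self_eq_norm_sq,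
        real_inner_comm (T u)] at this
      rwa [← sq]
    conv_lhs => rw [hT, inner_integral_pointOp hφ hb]
    rw [hn, ← integral_mul_const]
    refine integral_mono_of_nonneg (ae_of_all _ fun a => mul_self_nonneg _) (hint.mul_const _)
      (ae_of_all _ h1)
  by_contra hlt
  push Not at hlt
  have h2 : ‖T‖ ≤ n / (1 - n) * lam := opNorm_le_of_inner_le hTp
    (mul_nonneg (div_nonneg hn0 (by linarith)) hlam.le) fun u => by
      rw [div_mul_eq_mul_div, div_mul_eq_mul_div, le_div_iff₀ (by linarith)]
      linarith [key u]
  have h3 : n / (1 - n) < 1 := by rw [div_lt_one (by linarith)]; linarith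
  nlinarith

end Population

/-! ### The risk as a quadratic functional. -/

section Risk

variable {S : Type*} [TopologicalSpace S] [SecondCountableTopology S] [MeasurableSpace S]
  [OpensMeasurableSpace S]
  {F : Type*} [NormedAddCommGroup F] [InnerProductSpace ℝ F] [CompleteSpace F] [RKHS ℝ F S ℝ]
  (hφ : Continuous (feature F : S → F)) {b : ℝ} (hb : ∀ t : S, ‖feature F t‖ ≤ b)
  (ν : Measure (S × ℝ)) [IsProbabilityMeasure ν] {C : ℝ} (hC : ∀ᵐ z ∂ν, |z.2| ≤ C)

include hφ hb hC

theorem integrable_snd_smul_feature : Integrable (fun z : S × ℝ => z.2 • feature F z.1) ν := by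
  have hm : StronglyMeasurable fun z : S × ℝ => z.2 • feature F z.1 :=
    measurable_snd.stronglyMeasurable.smul (hφ.stronglyMeasurable.comp_measurable measurable_fst)
  refine Integrable.of_bound hm.aestronglyMeasurable (C * b) (hC.mono fun z hz => ?_)
  rw [norm_smul, Real.norm_eq_abs]
  exact mul_le_mul hz (hb _) (norm_nonneg _) ((abs_nonneg _).trans hz)

theorem integral_sq_sub_eq (f : F) :
    ∫ z, (f z.1 - z.2) ^ 2 ∂ν = inner ℝ ((∫ a, pointOp F a ∂ν.fst) f) f
      - 2 * inner ℝ (∫ z, z.2 • feature F z.1 ∂ν) f + ∫ z, z.2 ^ 2 ∂ν := by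
  have hf := continuous_rkhs_apply hφ f
  have hfm : Measurable fun z : S × ℝ => f z.1 := hf.measurable.comp measurable_fst
  have hgi := integrable_snd_smul_feature hφ hb ν hC
  have h1 : Integrable (fun z : S × ℝ => f z.1 * f z.1) ν :=
    Integrable.of_bound (hfm.mul hfm).aestronglyMeasurable ((b * ‖f‖) * (b * ‖f‖))
      (ae_of_all _ fun z => by
        have := abs_rkhs_apply_le hb f z.1
        rw [Real.norm_eq_abs, abs_mul]
        exact mul_le_mul this this (abs_nonneg _) ((abs_nonneg _).trans this))
  have h2 : Integrable (fun z : S × ℝ => inner ℝ f (z.2 • feature F z.1)) ν := hgi.const_inner f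
  have h3 : Integrable (fun z : S × ℝ => z.2 ^ 2) ν :=
    Integrable.of_bound (measurable_snd.pow_const 2).aestronglyMeasurable (C ^ 2)
      (hC.mono fun z hz => by
        rw [norm_pow, Real.norm_eq_abs]; gcongr)
  have h4 : ∀ z : S × ℝ, (f z.1 - z.2) ^ 2
      = f z.1 * f z.1 - 2 * inner ℝ f (z.2 • feature F z.1) + z.2 ^ 2 := fun z => by
    rw [inner_smul_right, inner_feature_right]; ring
  simp only [h4]
  rw [integral_add (by exact h1.sub (h2.const_mul 2)) h3, integral_sub h1 (h2.const_mul 2),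
    integral_const_mul, integral_inner hgi, inner_integral_pointOp hφ hb,
    real_inner_comm f]
  congr 2
  rw [Measure.fst, integral_map measurable_fst.aemeasurable
    (by fun_prop)]

end Risk

/-! ### Empirical operators -/

section Empirical

variable {S : Type*} {F : Type*} [NormedAddCommGroup F] [InnerProductSpace ℝ F] [CompleteSpace F]
  [RKHS ℝ F S ℝ]

variable (F) in
/-- The empirical second moment operator of the points `a i`. -/
noncomputable def empOp {l : ℕ} (a : Fin l → S) : F →L[ℝ] F := (1 / (l : ℝ)) • ∑ i, pointOp F (a i)

variable (F) in
/-- The empirical vector `l⁻¹ ∑ yᵢ κ(·, aᵢ)`. -/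
noncomputable def empVec {l : ℕ} (a : Fin l → S) (y : Fin l → ℝ) : F :=
  (1 / (l : ℝ)) • ∑ i, y i • feature F (a i)

variable {l : ℕ} (a : Fin l → S) (y : Fin l → ℝ)

theorem empOp_apply (u : F) : empOp F a u = (1 / (l : ℝ)) • ∑ i, u (a i) • feature F (a i) := by
  simp [empOp, sum_apply, pointOp_apply]

theorem inner_empOp (u v : F) :
    inner ℝ (empOp F a u) v = (1 / (l : ℝ)) * ∑ i, u (a i) * v (a i) := by
  simp [empOp_apply, inner_smul_left, sum_inner, inner_feature_left]

theorem inner_empVec (v : F) :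
    inner ℝ (empVec F a y) v = (1 / (l : ℝ)) * ∑ i, y i * v (a i) := by
  simp [empVec, inner_smul_left, sum_inner, inner_feature_left]

theorem empOp_isPositive : (empOp F a).IsPositive := by
  rw [isPositive_iff_real]
  refine ⟨?_, fun u => ?_⟩
  · rw [ContinuousLinearMap.isSelfAdjoint_iff_isSymmetric]
    intro u v
    change inner ℝ (empOp F a u) v = inner ℝ u (empOp F a v)
    rw [real_inner_comm _ u, inner_empOp, inner_empOp]
    simp only [mul_comm]
  · rw [inner_empOp]
    exact mul_nonneg (by positivity) (Finset.sum_nonneg fun i _ => mul_self_nonneg _)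

theorem empirical_risk_eq (f : F) :
    (1 / (l : ℝ)) * ∑ i, (f (a i) - y i) ^ 2 = inner ℝ (empOp F a f) f
      - 2 * inner ℝ (empVec F a y) f + (1 / (l : ℝ)) * ∑ i, y i ^ 2 := by
  have h : ∀ i, (f (a i) - y i) ^ 2 = f (a i) * f (a i) - 2 * (y i * f (a i)) + y i ^ 2 :=
    fun i => by ring
  simp only [h, Finset.sum_add_distrib, Finset.sum_sub_distrib, ← Finset.mul_sum, inner_empOp,
    inner_empVec]
  ring

theorem norm_empVec_le [NeZero l] {b C : ℝ} (hb : ∀ t : S, ‖feature F t‖ ≤ b)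
    (hC : ∀ i, |y i| ≤ C) : ‖empVec F a y‖ ≤ C * b := by
  have hl : (0 : ℝ) < l := Nat.cast_pos.2 (NeZero.pos l)
  rw [empVec, norm_smul, Real.norm_of_nonneg (by positivity)]
  have : ‖∑ i, y i • feature F (a i)‖ ≤ ∑ _i : Fin l, C * b :=
    norm_sum_le_of_le _ fun i _ => by
      rw [norm_smul, Real.norm_eq_abs]
      exact mul_le_mul (hC i) (hb _) (norm_nonneg _) ((abs_nonneg _).trans (hC i))
  simp only [Finset.sum_const, Finset.card_univ, Fintype.card_fin, nsmul_eq_mul] at this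
  rw [div_mul_eq_mul_div, one_mul, div_le_iff₀ hl]
  linarith

theorem norm_empVec_sub_le [NeZero l] {C ε : ℝ} (a' : Fin l → S)
    (hε : ∀ i, ‖feature F (a' i) - feature F (a i)‖ ≤ ε)
    (hC : ∀ i, |y i| ≤ C) : ‖empVec F a' y - empVec F a y‖ ≤ C * ε := by
  have hl : (0 : ℝ) < l := Nat.cast_pos.2 (NeZero.pos l)
  rw [empVec, empVec, ← smul_sub, ← Finset.sum_sub_distrib, norm_smul,
    Real.norm_of_nonneg (by positivity)]
  have : ‖∑ i, (y i • feature F (a' i) - y i • feature F (a i))‖ ≤ ∑ _i : Fin l, C * ε :=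
    norm_sum_le_of_le _ fun i _ => by
      rw [← smul_sub, norm_smul, Real.norm_eq_abs]
      exact mul_le_mul (hC i) (hε i) (norm_nonneg _) ((abs_nonneg _).trans (hC i))
  simp only [Finset.sum_const, Finset.card_univ, Fintype.card_fin, nsmul_eq_mul] at this
  rw [div_mul_eq_mul_div, one_mul, div_le_iff₀ hl]
  linarith

theorem norm_pointOp_sub_le {b : ℝ} (hb : ∀ t : S, ‖feature F t‖ ≤ b) (s t : S) (u : F) :
    ‖pointOp F s u - pointOp F t u‖ ≤ 2 * b * ‖feature F s - feature F t‖ * ‖u‖ := by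
  have h : pointOp F s u - pointOp F t u
      = u s • (feature F s - feature F t)
        + inner ℝ (feature F s - feature F t) u • feature F t := by
    rw [pointOp_apply, pointOp_apply, inner_sub_left, inner_feature_left, inner_feature_left,
      smul_sub, sub_smul]
    abel
  rw [h]
  refine (norm_add_le _ _).trans ?_
  rw [norm_smul, norm_smul, Real.norm_eq_abs, Real.norm_eq_abs]
  have h1 : |u s| * ‖feature F s - feature F t‖ ≤ (b * ‖u‖) * ‖feature F s - feature F t‖ := by
    gcongr; exact abs_rkhs_apply_le hb u s
  have h2 : |inner ℝ (feature F s - feature F t) u| * ‖feature F t‖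
      ≤ (‖feature F s - feature F t‖ * ‖u‖) * b :=
    mul_le_mul (abs_real_inner_le_norm _ _) (hb t) (norm_nonneg _) (by positivity)
  linarith

theorem norm_empOp_sub_le [NeZero l] {b ε : ℝ} (hb : ∀ t : S, ‖feature F t‖ ≤ b)
    (a' : Fin l → S) (hε : ∀ i, ‖feature F (a' i) - feature F (a i)‖ ≤ ε) (u : F) :
    ‖empOp F a' u - empOp F a u‖ ≤ 2 * b * ε * ‖u‖ := by
  have hl : (0 : ℝ) < l := Nat.cast_pos.2 (NeZero.pos l)
  rw [empOp, empOp, smul_apply, smul_apply, ← smul_sub, sum_apply,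
    sum_apply, ← Finset.sum_sub_distrib, norm_smul,
    Real.norm_of_nonneg (by positivity)]
  have : ‖∑ i, (pointOp F (a' i) u - pointOp F (a i) u)‖ ≤ ∑ _i : Fin l, 2 * b * ε * ‖u‖ :=
    norm_sum_le_of_le _ fun i _ => (norm_pointOp_sub_le hb _ _ u).trans (by
      have hb0 : 0 ≤ b := (norm_nonneg _).trans (hb (a i))
      gcongr
      exact hε i)
  simp only [Finset.sum_const, Finset.card_univ, Fintype.card_fin, nsmul_eq_mul] at this
  rw [div_mul_eq_mul_div, one_mul, div_le_iff₀ hl]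
  linarith

end Empirical

/-! ### Perturbation of regularized least squares -/

section Perturbation

theorem norm_sum_five_sq_le {E : Type*} [SeminormedAddCommGroup E] (a b c d e : E) :
    ‖a + b + c + d + e‖ ^ 2 ≤ 5 * (‖a‖ ^ 2 + ‖b‖ ^ 2 + ‖c‖ ^ 2 + ‖d‖ ^ 2 + ‖e‖ ^ 2) := by
  have h : ‖a + b + c + d + e‖ ≤ ‖a‖ + ‖b‖ + ‖c‖ + ‖d‖ + ‖e‖ :=
    (norm_add_le _ _).trans (by
      gcongr
      refine (norm_add_le _ _).trans (by
        gcongr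
        refine (norm_add_le _ _).trans (by
          gcongr
          exact norm_add_le _ _)))
  have h2 : ‖a + b + c + d + e‖ ^ 2 ≤ (‖a‖ + ‖b‖ + ‖c‖ + ‖d‖ + ‖e‖) ^ 2 := by gcongr
  nlinarith [sq_nonneg (‖a‖ - ‖b‖), sq_nonneg (‖a‖ - ‖c‖), sq_nonneg (‖a‖ - ‖d‖),
    sq_nonneg (‖a‖ - ‖e‖), sq_nonneg (‖b‖ - ‖c‖), sq_nonneg (‖b‖ - ‖d‖), sq_nonneg (‖b‖ - ‖e‖),
    sq_nonneg (‖c‖ - ‖d‖), sq_nonneg (‖c‖ - ‖e‖), sq_nonneg (‖d‖ - ‖e‖)]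

variable {E : Type*} [NormedAddCommGroup E] [InnerProductSpace ℝ E] [CompleteSpace E]
  {T B B' : E →L[ℝ] E} {lam : ℝ}

theorem norm_resolv_apply_le (hB : B.IsPositive) (hlam : 0 < lam) (v : E) :
    ‖resolv B lam v‖ ≤ ‖v‖ / lam := by
  set w := resolv B lam v with hw
  rw [le_div_iff₀ hlam]
  have h1 : lam * ‖w‖ ^ 2 ≤ ‖v‖ * ‖w‖ := by
    have h2 : inner ℝ v w = inner ℝ (B w) w + lam * ‖w‖ ^ 2 := by
      conv_lhs => rw [← apply_resolv_add hB hlam v]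
      rw [inner_add_left, inner_smul_left, real_inner_self_eq_norm_sq, RCLike.conj_to_real]
    linarith [inner_apply_self_nonneg hB w, real_inner_le_norm v w]
  rcases (norm_nonneg w).eq_or_lt with h0 | h0
  · rw [← h0, zero_mul]; exact norm_nonneg v
  · nlinarith

/-- With `w = (B + λ)⁻¹ v`, expanding `‖(B + λ) w‖²` produces `2λ ⟪B w, w⟫ + λ² ‖w‖²`, which
controls the hypothesis at `w` after multiplication by `κ / λ`. -/
theorem inner_resolv_apply_le (hB : B.IsPositive) (hlam : 0 < lam) {κ : ℝ} (hκ : 1 ≤ κ)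
    (h : ∀ u, inner ℝ (T u) u ≤ 2 * inner ℝ (B u) u + κ * lam * ‖u‖ ^ 2) (v : E) :
    inner ℝ (T (resolv B lam v)) (resolv B lam v) ≤ κ / lam * ‖v‖ ^ 2 := by
  set w := resolv B lam v with hw
  have h1 : ‖v‖ ^ 2 = ‖B w‖ ^ 2 + 2 * lam * inner ℝ (B w) w + lam ^ 2 * ‖w‖ ^ 2 := by
    conv_lhs => rw [← apply_resolv_add hB hlam v]
    rw [norm_add_sq_real, norm_smul, mul_pow, Real.norm_eq_abs, sq_abs, inner_smul_right]
    ring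
  refine (h w).trans ?_
  rw [div_mul_eq_mul_div, le_div_iff₀ hlam, h1]
  have h2 := inner_apply_self_nonneg hB w
  have h3 : 0 ≤ κ * ‖B w‖ ^ 2 := by positivity
  have h4 : 0 ≤ (κ - 1) * (lam * inner ℝ (B w) w) :=
    mul_nonneg (by linarith) (mul_nonneg hlam.le h2)
  nlinarith

/-- Unlike the cruder `‖v‖² / λ`, this bound keeps the resolvent weight, through which the effective
dimension enters the noise term. With `w = (B + λ)⁻¹ v` and `q = ⟪(T + λ) w, w⟫`, the hypothesis
gives `q ≤ 2⟪v, w⟫`, and Cauchy–Schwarz gives `⟪v, w⟫² ≤ ⟪(T + λ)⁻¹ v, v⟫ q`. -/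
theorem inner_resolv_apply_le_resolv (hT : T.IsPositive) (hB : B.IsPositive) (hlam : 0 < lam)
    (h : ∀ u, inner ℝ (T u) u ≤ 2 * inner ℝ (B u) u + lam * ‖u‖ ^ 2) (v : E) :
    inner ℝ (T (resolv B lam v)) (resolv B lam v) ≤ 4 * inner ℝ (resolv T lam v) v := by
  set w := resolv B lam v with hw
  have hR := resolv_isPositive hT hlam
  have h1 : inner ℝ v w = inner ℝ (B w) w + lam * ‖w‖ ^ 2 := by
    conv_lhs => rw [← apply_resolv_add hB hlam v]
    rw [inner_add_left, inner_smul_left, real_inner_self_eq_norm_sq, RCLike.conj_to_real]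
  set q := inner ℝ (T w) w + lam * ‖w‖ ^ 2 with hq
  have hTw := inner_apply_self_nonneg hT w
  have h2 : inner ℝ v w ^ 2 ≤ inner ℝ (resolv T lam v) v * q := by
    have := inner_apply_sq_le hR v (T w + lam • w)
    rwa [hR.inner_left_eq_inner_right v (T w + lam • w), resolv_apply_add hT hlam,
      inner_add_right, inner_smul_right, real_inner_self_eq_norm_sq, real_inner_comm (T w)] at this
  have h3 : q ≤ 2 * inner ℝ v w := by
    rw [h1]; linarith [h w]
  have hw0 : 0 ≤ lam * ‖w‖ ^ 2 := by positivity
  have h4 : inner ℝ (T w) w ≤ q := by linarith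
  refine h4.trans ?_
  have hq0 : 0 ≤ q := hTw.trans h4
  rcases hq0.eq_or_lt with h0 | h0
  · rw [← h0]
    exact mul_nonneg (by norm_num) (inner_apply_self_nonneg hR v)
  · have h5 : q * q ≤ (4 * inner ℝ (resolv T lam v) v) * q := by nlinarith
    exact le_of_mul_le_mul_right h5 h0

/-- Excess risk of a regularized solution with operator `B'` and data `g''`, compared in two steps
(through `B`, `g'`) with the minimizer `f₀` of the risk with operator `T`. -/
theorem inner_sub_resolv_le (hT : T.IsPositive) (hB : B.IsPositive) (hB' : B'.IsPositive)
    (hlam : 0 < lam) (h : ∀ u, inner ℝ (T u) u ≤ 2 * inner ℝ (B u) u + lam * ‖u‖ ^ 2)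
    (h' : ∀ u, ‖B u - B' u‖ ≤ lam / 4 * ‖u‖) (f₀ g' g'' : E) :
    inner ℝ (T (resolv B' lam g'' - f₀)) (resolv B' lam g'' - f₀) ≤
      5 * (4 / lam * ‖g'' - g'‖ ^ 2 + 4 / lam * ‖B (resolv B lam g') - B' (resolv B lam g')‖ ^ 2
        + inner ℝ (T (resolv T lam (T f₀) - f₀)) (resolv T lam (T f₀) - f₀)
        + 4 * inner ℝ (resolv T lam (g' - B f₀)) (g' - B f₀)
        + 1 / lam * ‖T (resolv T lam (T f₀) - f₀) - B (resolv T lam (T f₀) - f₀)‖ ^ 2) := by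
  set fl := resolv T lam (T f₀) with hfl
  set fz := resolv B lam g' with hfz
  have e1 : resolv B' lam g'' - fz
      = resolv B' lam (g'' - g') + resolv B' lam (B fz - B' fz) := by
    have h1 : fz = resolv B' lam (B' fz + lam • fz) := (resolv_apply_add hB' hlam fz).symm
    have h2 : B fz + lam • fz = g' := apply_resolv_add hB hlam g'
    conv_lhs => rw [h1]
    rw [← map_sub, ← map_add, ← h2]
    congr 1
    abel
  -- Applying `B + λ` to `fz - fl` and substituting `λ fl = T f₀ - T fl` leaves `(g' - B f₀) + (T -
  -- B)(fl - f₀)`.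
  have e2 : fz - fl
      = resolv B lam (g' - B f₀) + resolv B lam (T (fl - f₀) - B (fl - f₀)) := by
    have h1 : fl = resolv B lam (B fl + lam • fl) := (resolv_apply_add hB hlam fl).symm
    have h2 : T fl + lam • fl = T f₀ := apply_resolv_add hT hlam (T f₀)
    have h3 : lam • fl = T f₀ - T fl := by rw [← h2]; abel
    conv_lhs => rw [h1]
    rw [hfz, ← map_sub, ← map_add, h3]
    congr 1
    simp only [map_sub]
    abel
  have e3 : resolv B' lam g'' - f₀ = resolv B' lam (g'' - g') + resolv B' lam (B fz - B' fz)
      + (fl - f₀) + resolv B lam (g' - B f₀) + resolv B lam (T (fl - f₀) - B (fl - f₀)) := by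
    have : resolv B' lam g'' - f₀ = (resolv B' lam g'' - fz) + (fz - fl) + (fl - f₀) := by abel
    rw [this, e1, e2]
    abel
  -- Exchanging `B` for `B'` costs twice `λ/4`, whence the constant 3/2, which is below the 4 used
  -- next.
  have hpert : ∀ u, inner ℝ (T u) u ≤ 2 * inner ℝ (B' u) u + (3 / 2) * lam * ‖u‖ ^ 2 := fun u => by
    have h1 : inner ℝ (B u) u - inner ℝ (B' u) u ≤ lam / 4 * ‖u‖ ^ 2 := by
      rw [← inner_sub_left]
      refine (real_inner_le_norm _ _).trans ?_
      rw [sq, ← mul_assoc]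
      gcongr
      exact h' u
    linarith [h u]
  have b1 : ∀ v, inner ℝ (T (resolv B' lam v)) (resolv B' lam v) ≤ 4 / lam * ‖v‖ ^ 2 := fun v =>
    (inner_resolv_apply_le hB' hlam (by norm_num) hpert v).trans (by gcongr; norm_num)
  have b2 := fun v => inner_resolv_apply_le (κ := 1) hB hlam le_rfl (by simpa using h) v
  have b3 := inner_resolv_apply_le_resolv hT hB hlam h (g' - B f₀)
  rw [e3, ← norm_opSqrt_sq hT]
  simp only [map_add (opSqrt T)]
  refine (norm_sum_five_sq_le _ _ _ _ _).trans ?_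
  simp only [norm_opSqrt_sq hT]
  gcongr
  · exact b1 _
  · exact b1 _
  · exact b2 _

end Perturbation

/-! ### Concentration of the empirical operators -/

section BoundedBernstein

variable {Ω : Type*} [MeasurableSpace Ω] (P : Measure Ω) [IsProbabilityMeasure P]
variable {E : Type*} [NormedAddCommGroup E] [InnerProductSpace ℝ E] [CompleteSpace E]

theorem integral_norm_sub_mean_sq_le {ζ : Ω → E} (hi : Integrable ζ P)
    (hi2 : Integrable (fun ω => ‖ζ ω‖ ^ 2) P) :
    Integrable (fun ω => ‖ζ ω - ∫ x, ζ x ∂P‖ ^ 2) P ∧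
    ∫ ω, ‖ζ ω - ∫ x, ζ x ∂P‖ ^ 2 ∂P ≤ ∫ ω, ‖ζ ω‖ ^ 2 ∂P := by
  set m := ∫ x, ζ x ∂P with hm
  have hin : Integrable (fun ω => 2 * inner ℝ m (ζ ω)) P := (hi.const_inner m).const_mul 2
  have h : ∀ ω, ‖ζ ω - m‖ ^ 2 = ‖ζ ω‖ ^ 2 - 2 * inner ℝ m (ζ ω) + ‖m‖ ^ 2 := fun ω => by
    rw [norm_sub_sq_real, real_inner_comm]
  simp only [h]
  refine ⟨(hi2.sub hin).add (integrable_const _), ?_⟩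
  rw [integral_add (by exact hi2.sub hin) (integrable_const _), integral_sub hi2 hin,
    integral_const_mul, integral_inner hi, ← hm, real_inner_self_eq_norm_sq]
  simp
  linarith [sq_nonneg ‖m‖]

/-- Bernstein's inequality for bounded vectors. -/
theorem measure_norm_sum_sub_mean_gt_le {ζ : Ω → E} (hζ : StronglyMeasurable ζ) {B v D : ℝ}
    (hB : ∀ ω, ‖ζ ω‖ ≤ B) (hv : ∫ ω, ‖ζ ω‖ ^ 2 ∂P ≤ v) {n : ℕ} (hn : 0 < n) (hD : 0 < D)
    (hBD : 2 * B ≤ D) (hvD : n * v ≤ D ^ 2) {τ : ℝ} (hτ : 1 ≤ τ) :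
    (Measure.pi fun _ : Fin n => P) {w | 2 * D * τ < ‖∑ i, (ζ (w i) - ∫ x, ζ x ∂P)‖}
      ≤ ENNReal.ofReal (2 * Real.exp (-τ)) := by
  have hi : Integrable ζ P := Integrable.of_bound hζ.aestronglyMeasurable B (ae_of_all _ hB)
  have hi2 : Integrable (fun ω => ‖ζ ω‖ ^ 2) P :=
    Integrable.of_bound (hζ.norm.pow 2).aestronglyMeasurable (B ^ 2) (ae_of_all _ fun ω => by
      rw [norm_pow, norm_norm]
      gcongr
      exact hB ω)
  obtain ⟨hc, hcle⟩ := integral_norm_sub_mean_sq_le P hi hi2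
  set m := ∫ x, ζ x ∂P with hm
  have hn' : (0 : ℝ) < n := Nat.cast_pos.2 hn
  have hmB : ‖m‖ ≤ B := by
    simpa using norm_integral_le_of_norm_le_const (μ := P) (ae_of_all _ hB)
  refine measure_norm_sum_gt_le P (ξ := fun ω => ζ ω - m) (hζ.sub stronglyMeasurable_const)
    (hi.sub (integrable_const m)) ?_ hn hD ?_ hτ
  · rw [integral_sub hi (integrable_const m)]
    simp [hm]
  · calc ∫⁻ ω, ENNReal.ofReal (Real.exp (‖ζ ω - m‖ / D) - ‖ζ ω - m‖ / D - 1) ∂P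
        ≤ ∫⁻ ω, ENNReal.ofReal ((D ^ 2)⁻¹ * ‖ζ ω - m‖ ^ 2) ∂P := by
          refine lintegral_mono fun ω => ENNReal.ofReal_le_ofReal ?_
          -- Centring at most doubles the bound `B`, so `2 * B ≤ D` puts the argument in `[0, 1]`,
          -- where `exp u - u - 1 ≤ u²`.
          refine (exp_sub_self_sub_one_le_sq (by positivity) ?_).trans (le_of_eq ?_)
          · rw [div_le_one hD]
            exact (norm_sub_le _ _).trans (by linarith [hB ω])
          · rw [div_pow, div_eq_inv_mul]
      _ = ENNReal.ofReal ((D ^ 2)⁻¹ * ∫ ω, ‖ζ ω - m‖ ^ 2 ∂P) := by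
          rw [← integral_const_mul, ofReal_integral_eq_lintegral_ofReal (hc.const_mul _)
            (ae_of_all _ fun ω => by positivity)]
      _ ≤ ENNReal.ofReal (1 / n) := by
          apply ENNReal.ofReal_le_ofReal
          rw [inv_mul_eq_div, div_le_div_iff₀ (by positivity) hn']
          nlinarith

end BoundedBernstein

/-! ### Deviation of the empirical operator and of the noise. -/

section Concentration

variable {S : Type*} [TopologicalSpace S] [SecondCountableTopology S] [MeasurableSpace S]
  [OpensMeasurableSpace S]
  {F : Type*} [NormedAddCommGroup F] [InnerProductSpace ℝ F] [CompleteSpace F] [RKHS ℝ F S ℝ]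
  (hφ : Continuous (feature F : S → F)) {b : ℝ} (hb : ∀ t : S, ‖feature F t‖ ≤ b)
  (ν : Measure (S × ℝ)) [IsProbabilityMeasure ν]

include hφ hb

theorem measure_norm_cov_sub_empOp_gt_le (d : F) {l : ℕ} (hl : 0 < l) (hd : 0 < b ^ 2 * ‖d‖)
    {τ : ℝ} (hτ : 1 ≤ τ) :
    (Measure.pi fun _ : Fin l => ν) {z | 2 * (2 * (b ^ 2 * ‖d‖)
      + √(l * (b ^ 2 * inner ℝ ((∫ a, pointOp F a ∂ν.fst) d) d))) * τ / l
        < ‖(∫ a, pointOp F a ∂ν.fst) d - empOp F (fun i => (z i).1) d‖}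
      ≤ ENNReal.ofReal (2 * Real.exp (-τ)) := by
  set T := ∫ a, pointOp F a ∂ν.fst with hT
  have hTp : T.IsPositive := integral_pointOp_isPositive hφ hb ν.fst
  have hq := inner_apply_self_nonneg hTp d
  have hl' : (0 : ℝ) < l := Nat.cast_pos.2 hl
  have hdc := continuous_rkhs_apply hφ d
  have hmeas : StronglyMeasurable fun a : S => d a • feature F a := (hdc.smul hφ).stronglyMeasurable
  have hint : ∫ z : S × ℝ, d z.1 • feature F z.1 ∂ν = T d := by
    rw [hT, integral_pointOp_apply hφ hb, Measure.fst,
      integral_map measurable_fst.aemeasurable hmeas.aestronglyMeasurable]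
  have key := measure_norm_sum_sub_mean_gt_le ν (ζ := fun z : S × ℝ => d z.1 • feature F z.1)
    (hmeas.comp_measurable measurable_fst) (B := b ^ 2 * ‖d‖)
    (v := b ^ 2 * inner ℝ (T d) d)
    (D := 2 * (b ^ 2 * ‖d‖) + √(l * (b ^ 2 * inner ℝ (T d) d))) (fun z => by
      have h1 := abs_rkhs_apply_le hb d z.1
      rw [norm_smul, Real.norm_eq_abs]
      refine (mul_le_mul h1 (hb z.1) (norm_nonneg _) ((abs_nonneg _).trans h1)).trans (le_of_eq ?_)
      ring) (by
      have h2 : inner ℝ (T d) d = ∫ z : S × ℝ, d z.1 * d z.1 ∂ν := by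
        rw [hT, inner_integral_pointOp hφ hb, Measure.fst,
          integral_map measurable_fst.aemeasurable (by fun_prop)]
      have hi : Integrable (fun z : S × ℝ => d z.1 * d z.1) ν := by
        have hm : StronglyMeasurable fun z : S × ℝ => d z.1 * d z.1 :=
          (hdc.mul hdc).stronglyMeasurable.comp_measurable measurable_fst
        refine Integrable.of_bound hm.aestronglyMeasurable ((b * ‖d‖) * (b * ‖d‖))
          (ae_of_all _ fun z => ?_)
        have := abs_rkhs_apply_le hb d z.1
        rw [Real.norm_eq_abs, abs_mul]
        exact mul_le_mul this this (abs_nonneg _) ((abs_nonneg _).trans this)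
      rw [h2, ← integral_const_mul]
      refine integral_mono_of_nonneg (ae_of_all _ fun z => by positivity) (hi.const_mul _)
        (ae_of_all _ fun z => ?_)
      simp only
      rw [norm_smul, mul_pow, Real.norm_eq_abs, sq_abs, mul_comm, sq (d z.1)]
      have := hb z.1
      gcongr
      exact mul_self_nonneg _) hl (by positivity)
    (by linarith [Real.sqrt_nonneg (l * (b ^ 2 * inner ℝ (T d) d))]) (by
      have h3 := Real.sq_sqrt (show 0 ≤ l * (b ^ 2 * inner ℝ (T d) d) by positivity)
      have h4 := Real.sqrt_nonneg (l * (b ^ 2 * inner ℝ (T d) d))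
      nlinarith) hτ
  refine (measure_mono fun z hz => ?_).trans key
  simp only [Set.mem_ofPred_eq] at hz ⊢
  rw [div_lt_iff₀ hl'] at hz
  refine hz.trans_le (le_of_eq ?_)
  rw [hint, Finset.sum_sub_distrib, empOp_apply, norm_sub_rev, mul_comm,
    ← Real.norm_of_nonneg hl'.le, ← norm_smul, smul_sub, smul_smul]
  simp [hl'.ne', Nat.cast_smul_eq_nsmul]

theorem integral_norm_opSqrt_resolv_sq {lam : ℝ} (hlam : 0 < lam) :
    ∫ a, inner ℝ (resolv (∫ a, pointOp F a ∂ν.fst) lam (feature F a)) (feature F a) ∂ν.fst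
      = ∫ z : S × ℝ, ‖opSqrt (resolv (∫ a, pointOp F a ∂ν.fst) lam) (feature F z.1)‖ ^ 2 ∂ν := by
  have hR := resolv_isPositive (integral_pointOp_isPositive hφ hb ν.fst) hlam
  set R := resolv (∫ a, pointOp F a ∂ν.fst) lam with hRdef
  have hRc : Continuous fun a => R (feature F a) := R.continuous.comp hφ
  simp only [norm_opSqrt_sq hR]
  rw [Measure.fst, integral_map measurable_fst.aemeasurable
    (hRc.inner hφ).stronglyMeasurable.aestronglyMeasurable]

theorem norm_opSqrt_resolv_feature_sq_le {lam : ℝ} (hlam : 0 < lam) (a : S) :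
    ‖opSqrt (resolv (∫ a, pointOp F a ∂ν.fst) lam) (feature F a)‖ ^ 2 ≤ b ^ 2 / lam := by
  have hT := integral_pointOp_isPositive hφ hb ν.fst
  rw [norm_opSqrt_sq (resolv_isPositive hT hlam)]
  refine (inner_resolv_self_le hT hlam _).trans ?_
  gcongr
  exact hb a

/-- The empirical operator dominates half of the population operator, up to regularization. -/
theorem measure_not_loewner_le {lam : ℝ} (hlam : 0 < lam) {l : ℕ} (hl : 0 < l) (hb0 : 0 < b)
    {n τ : ℝ} (hτ : 1 ≤ τ)
    (hn : n = ∫ a, inner ℝ (resolv (∫ a, pointOp F a ∂ν.fst) lam (feature F a)) (feature F a)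
      ∂ν.fst)
    (hsmall : 2 * (2 * (b ^ 2 / lam) + √(l * (b ^ 2 / lam * n))) * τ ≤ l / 2) :
    ∃ G : Set (Fin l → S × ℝ), MeasurableSet G ∧
      (Measure.pi fun _ : Fin l => ν) Gᶜ ≤ ENNReal.ofReal (2 * Real.exp (-τ)) ∧
      ∀ z ∈ G, ∀ u : F, inner ℝ ((∫ a, pointOp F a ∂ν.fst) u) u
        ≤ 2 * inner ℝ (empOp F (fun i => (z i).1) u) u + lam * ‖u‖ ^ 2 := by
  set T := ∫ a, pointOp F a ∂ν.fst with hT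
  have hTp : T.IsPositive := integral_pointOp_isPositive hφ hb ν.fst
  have hR := resolv_isPositive hTp hlam
  set V := opSqrt (resolv T lam) with hV
  have hl' : (0 : ℝ) < l := Nat.cast_pos.2 hl
  have hn2 : n = ∫ z : S × ℝ, ‖V (feature F z.1)‖ ^ 2 ∂ν :=
    hn.trans (integral_norm_opSqrt_resolv_sq hφ hb ν hlam)
  have hn0 : 0 ≤ n := by rw [hn2]; exact integral_nonneg fun z => by positivity
  have hVb : ∀ a, ‖V (feature F a)‖ ^ 2 ≤ b ^ 2 / lam :=
    norm_opSqrt_resolv_feature_sq_le hφ hb ν hlam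
  have hVc : Continuous fun a : S => V (feature F a) := V.continuous.comp hφ
  -- The completed tensor square is a Hilbert space standing in for the Hilbert–Schmidt operators,
  -- with `v ⊗ v` for the rank-one operator of `v`; the vector Bernstein inequality applies in it.
  let W := UniformSpace.Completion (TensorProduct ℝ F F)
  let ten : F → W := fun v => ((v ⊗ₜ[ℝ] v : TensorProduct ℝ F F) : W)
  have hten : Continuous ten :=
    (UniformSpace.Completion.continuous_coe _).comp
      (TensorProduct.continuous_tmul.comp (continuous_id.prodMk continuous_id))
  have htn : ∀ v, ‖ten v‖ = ‖v‖ ^ 2 := fun v => by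
    simp only [ten]
    rw [UniformSpace.Completion.norm_coe, TensorProduct.norm_tmul, sq]
  have hti : ∀ u v, inner ℝ (ten u) (ten v) = inner ℝ u v ^ 2 := fun u v => by
    simp only [ten]
    rw [UniformSpace.Completion.inner_coe, TensorProduct.inner_tmul, sq]
  let ζ : S × ℝ → W := fun z => ten (V (feature F z.1))
  have hζm : StronglyMeasurable ζ :=
    (hten.comp hVc).stronglyMeasurable.comp_measurable measurable_fst
  have hζb : ∀ z, ‖ζ z‖ ≤ b ^ 2 / lam := fun z => by
    simp only [ζ, htn]; exact hVb z.1
  have hζi : Integrable ζ ν := Integrable.of_bound hζm.aestronglyMeasurable _ (ae_of_all _ hζb)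
  set D := 2 * (b ^ 2 / lam) + √(l * (b ^ 2 / lam * n)) with hD
  have key := measure_norm_sum_sub_mean_gt_le ν hζm (v := b ^ 2 / lam * n) (D := D) hζb (by
      have hi : Integrable (fun z : S × ℝ => ‖V (feature F z.1)‖ ^ 2) ν := by
        have hm : StronglyMeasurable fun z : S × ℝ => ‖V (feature F z.1)‖ ^ 2 :=
          (hVc.norm.pow 2).stronglyMeasurable.comp_measurable measurable_fst
        exact Integrable.of_bound hm.aestronglyMeasurable (b ^ 2 / lam) (ae_of_all _ fun z => by
          rw [Real.norm_of_nonneg (by positivity)]; exact hVb z.1)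
      rw [hn2, ← integral_const_mul]
      refine integral_mono_of_nonneg (ae_of_all _ fun z => by positivity) (hi.const_mul _)
        (ae_of_all _ fun z => ?_)
      simp only [ζ, htn]
      rw [sq]
      gcongr
      exact hVb z.1) hl (by positivity)
    (by linarith [Real.sqrt_nonneg (l * (b ^ 2 / lam * n))]) (by
      have h3 := Real.sq_sqrt (show 0 ≤ l * (b ^ 2 / lam * n) by positivity)
      have h4 := Real.sqrt_nonneg (l * (b ^ 2 / lam * n))
      have h5 : 0 < b ^ 2 / lam := by positivity
      nlinarith) hτ
  refine ⟨{w | 2 * D * τ < ‖∑ i, (ζ (w i) - ∫ x, ζ x ∂ν)‖}ᶜ, ?_, by rwa [compl_compl], ?_⟩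
  · exact (measurableSet_lt measurable_const (stronglyMeasurable_pi_sum
      (hζm.sub stronglyMeasurable_const) l).norm.measurable).compl
  · intro z hz u
    rw [Set.mem_compl_iff, Set.mem_ofPred_eq, not_lt] at hz
    have hz' := hz.trans hsmall
    -- Testing against `V x ⊗ V x` recovers `u a ^ 2` from each summand, while its norm is `⟪T u, u⟫
    -- + λ ‖u‖²`. One norm bound of `l / 2` thus serves every `u` simultaneously.
    set x := T u + lam • u with hx
    have hxu : inner ℝ (V x) (V x) = inner ℝ (T u) u + lam * ‖u‖ ^ 2 := by
      rw [hV, inner_opSqrt_opSqrt hR, hx, resolv_apply_add hTp hlam, inner_add_right,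
        inner_smul_right, real_inner_self_eq_norm_sq, real_inner_comm]
    have hev : ∀ a, inner ℝ (V x) (V (feature F a)) = u a := fun a => by
      rw [hV, inner_opSqrt_opSqrt hR, hx, resolv_apply_add hTp hlam, inner_feature_right]
    have hmean : inner ℝ (ten (V x)) (∫ z, ζ z ∂ν) = inner ℝ (T u) u := by
      have hu := continuous_rkhs_apply hφ u
      rw [← integral_inner hζi, hT, inner_integral_pointOp hφ hb, Measure.fst,
        integral_map measurable_fst.aemeasurable (by fun_prop)]
      simp only [ζ, hti, hev, sq]
    have hip : inner ℝ (ten (V x)) (∑ i, (ζ (z i) - ∫ x, ζ x ∂ν))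
        = l * (inner ℝ (empOp F (fun i => (z i).1) u) u - inner ℝ (T u) u) := by
      rw [inner_sum]
      simp only [inner_sub_right, hmean, Finset.sum_sub_distrib]
      simp only [ζ, hti, hev, inner_empOp, sq]
      simp
      field_simp
    have h6 : -(‖ten (V x)‖ * ‖∑ i, (ζ (z i) - ∫ x, ζ x ∂ν)‖)
        ≤ l * (inner ℝ (empOp F (fun i => (z i).1) u) u - inner ℝ (T u) u) := by
      rw [← hip]
      exact (abs_le.1 (abs_real_inner_le_norm _ _)).1
    rw [htn, ← real_inner_self_eq_norm_sq, hxu] at h6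
    have h7 : 0 ≤ inner ℝ (T u) u + lam * ‖u‖ ^ 2 := by
      rw [← hxu]; exact real_inner_self_nonneg
    have h8 := mul_le_mul_of_nonneg_left hz' h7
    have h9 : l * (inner ℝ (T u) u) ≤
        l * (2 * inner ℝ (empOp F (fun i => (z i).1) u) u + lam * ‖u‖ ^ 2) := by linarith
    exact le_of_mul_le_mul_left h9 hl'

/-- Concentration of the noise term, in the norm weighted by the resolvent. -/
theorem measure_noise_gt_le {C : ℝ} (hC : ∀ᵐ z ∂ν, |z.2| ≤ C) {lam : ℝ} (hlam : 0 < lam)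
    {l : ℕ} (hl : 0 < l) (hb0 : 0 < b) {n τ : ℝ} (hτ : 1 ≤ τ)
    (hn : n = ∫ a, inner ℝ (resolv (∫ a, pointOp F a ∂ν.fst) lam (feature F a)) (feature F a)
      ∂ν.fst) {f₀ : F}
    (hf₀ : (∫ a, pointOp F a ∂ν.fst) f₀ = ∫ z, z.2 • feature F z.1 ∂ν) {M Sig : ℝ} (hM : 0 < M)
    (hSig : 0 < Sig)
    (hnoise : ∀ᵐ a ∂ν.fst, ∫⁻ y, ENNReal.ofReal (Real.exp (|y - f₀ a| / M) - |y - f₀ a| / M - 1)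
      ∂(ν.condKernel a) ≤ ENNReal.ofReal (Sig ^ 2 / (2 * M ^ 2))) :
    (Measure.pi fun _ : Fin l => ν) {z | 2 * (M * √(b ^ 2 / lam) + √(l * (Sig ^ 2 * n))) * τ / l <
      ‖opSqrt (resolv (∫ a, pointOp F a ∂ν.fst) lam)
        (empVec F (fun i => (z i).1) (fun i => (z i).2) - empOp F (fun i => (z i).1) f₀)‖}
      ≤ ENNReal.ofReal (2 * Real.exp (-τ)) := by
  set T := ∫ a, pointOp F a ∂ν.fst with hT
  have hTp : T.IsPositive := integral_pointOp_isPositive hφ hb ν.fst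
  have hR := resolv_isPositive hTp hlam
  set V := opSqrt (resolv T lam) with hV
  have hl' : (0 : ℝ) < l := Nat.cast_pos.2 hl
  have hn2 : n = ∫ z : S × ℝ, ‖V (feature F z.1)‖ ^ 2 ∂ν :=
    hn.trans (integral_norm_opSqrt_resolv_sq hφ hb ν hlam)
  have hn0 : 0 ≤ n := by rw [hn2]; exact integral_nonneg fun z => by positivity
  have hVb : ∀ a, ‖V (feature F a)‖ ^ 2 ≤ b ^ 2 / lam :=
    norm_opSqrt_resolv_feature_sq_le hφ hb ν hlam
  have hVc : Continuous fun a : S => V (feature F a) := V.continuous.comp hφ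
  have hfc := continuous_rkhs_apply hφ f₀
  have hfm : Measurable fun z : S × ℝ => f₀ z.1 := hfc.measurable.comp measurable_fst
  have hTi : Integrable (fun z : S × ℝ => f₀ z.1 • feature F z.1) ν := by
    have hm : StronglyMeasurable fun z : S × ℝ => f₀ z.1 • feature F z.1 :=
      (hfc.smul hφ).stronglyMeasurable.comp_measurable measurable_fst
    refine Integrable.of_bound hm.aestronglyMeasurable (b * ‖f₀‖ * b) (ae_of_all _ fun z => ?_)
    have h1 := abs_rkhs_apply_le hb f₀ z.1
    rw [norm_smul, Real.norm_eq_abs]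
    exact mul_le_mul h1 (hb z.1) (norm_nonneg _) ((abs_nonneg _).trans h1)
  have hyi := integrable_snd_smul_feature hφ hb ν hC
  -- Centred by the normal equation `hf₀` alone; `f₀` need not be the conditional mean of the label.
  let ζ : S × ℝ → F := fun z => z.2 • feature F z.1 - f₀ z.1 • feature F z.1
  have hζi : Integrable ζ ν := hyi.sub hTi
  have hζ0 : ∫ z, ζ z ∂ν = 0 := by
    have : ∫ z : S × ℝ, f₀ z.1 • feature F z.1 ∂ν = T f₀ := by
      have hm : StronglyMeasurable fun a : S => f₀ a • feature F a :=
        (hfc.smul hφ).stronglyMeasurable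
      rw [hT, integral_pointOp_apply hφ hb, Measure.fst, integral_map measurable_fst.aemeasurable
        hm.aestronglyMeasurable]
    simp only [ζ]
    rw [integral_sub hyi hTi, this, hf₀, sub_self]
  have hζm : StronglyMeasurable ζ :=
    (measurable_snd.stronglyMeasurable.smul
      (hφ.stronglyMeasurable.comp_measurable measurable_fst)).sub
      ((hfc.smul hφ).stronglyMeasurable.comp_measurable measurable_fst)
  have hVζ : ∀ z, ‖V (ζ z)‖ = ‖V (feature F z.1)‖ * |z.2 - f₀ z.1| := fun z => by
    simp only [ζ]
    rw [← sub_smul, map_smul, norm_smul, Real.norm_eq_abs, mul_comm]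
  set D := M * √(b ^ 2 / lam) + √(l * (Sig ^ 2 * n)) with hD
  have hD0 : 0 < D := by positivity
  have hc1 : ∀ a, ‖V (feature F a)‖ * M / D ≤ 1 := fun a => by
    rw [div_le_one hD0]
    have : ‖V (feature F a)‖ ≤ √(b ^ 2 / lam) := Real.le_sqrt_of_sq_le (hVb a)
    have := mul_le_mul_of_nonneg_left this hM.le
    have := Real.sqrt_nonneg (l * (Sig ^ 2 * n))
    linarith
  have hD2 : l * (Sig ^ 2 * n) ≤ D ^ 2 := by
    have h3 := Real.sq_sqrt (show 0 ≤ l * (Sig ^ 2 * n) by positivity)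
    have h4 := Real.sqrt_nonneg (l * (Sig ^ 2 * n))
    have h5 : 0 < M * √(b ^ 2 / lam) := by positivity
    nlinarith
  have key := measure_norm_sum_gt_le ν (ξ := fun z => V (ζ z))
    (V.continuous.comp_stronglyMeasurable hζm) (V.integrable_comp hζi)
    (by rw [V.integral_comp_comm hζi, hζ0, map_zero]) hl hD0 (by
      have hmeas : Measurable fun z : S × ℝ =>
          ENNReal.ofReal (Real.exp (‖V (ζ z)‖ / D) - ‖V (ζ z)‖ / D - 1) := by
        have : Measurable fun z => ‖V (ζ z)‖ :=
          (V.continuous.comp_stronglyMeasurable hζm).norm.measurable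
        fun_prop
      -- The noise hypothesis is conditional on the input, so the label is integrated first. Its
      -- contribution scales with `‖V φ_a‖²`, whose mean is `n`.
      conv_lhs => rw [← ν.disintegrate ν.condKernel]
      rw [Measure.lintegral_compProd hmeas]
      have hle : ∀ᵐ a ∂ν.fst, ∫⁻ y, ENNReal.ofReal (Real.exp (‖V (ζ (a, y))‖ / D)
          - ‖V (ζ (a, y))‖ / D - 1) ∂(ν.condKernel a) ≤
          ENNReal.ofReal (Sig ^ 2 / (2 * D ^ 2) * ‖V (feature F a)‖ ^ 2) := by
        filter_upwards [hnoise] with a ha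
        set c := ‖V (feature F a)‖ * M / D with hc
        have hc0 : 0 ≤ c := by positivity
        calc _ ≤ ∫⁻ y, ENNReal.ofReal (c ^ 2) * ENNReal.ofReal
                (Real.exp (|y - f₀ a| / M) - |y - f₀ a| / M - 1) ∂(ν.condKernel a) := by
              refine lintegral_mono fun y => ?_
              rw [← ENNReal.ofReal_mul (by positivity)]
              apply ENNReal.ofReal_le_ofReal
              have h1 : ‖V (ζ (a, y))‖ / D = c * (|y - f₀ a| / M) := by
                rw [hVζ, hc]; field_simp
              rw [h1]
              exact exp_mul_sub_le hc0 (hc1 a) (by positivity)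
          _ ≤ ENNReal.ofReal (c ^ 2) * ENNReal.ofReal (Sig ^ 2 / (2 * M ^ 2)) := by
              rw [lintegral_const_mul' _ _ ENNReal.ofReal_ne_top]
              gcongr
          _ = _ := by
              rw [← ENNReal.ofReal_mul (by positivity), hc]
              congr 1
              field_simp
      refine (lintegral_mono_ae hle).trans ?_
      have hi : Integrable (fun a => ‖V (feature F a)‖ ^ 2) ν.fst :=
        Integrable.of_bound (hVc.norm.pow 2).stronglyMeasurable.aestronglyMeasurable (b ^ 2 / lam)
          (ae_of_all _ fun a => by rw [Real.norm_of_nonneg (by positivity)]; exact hVb a)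
      rw [← ofReal_integral_eq_lintegral_ofReal (hi.const_mul _)
        (ae_of_all _ fun a => by positivity), integral_const_mul]
      apply ENNReal.ofReal_le_ofReal
      have hn3 : ∫ a, ‖V (feature F a)‖ ^ 2 ∂ν.fst = n := by
        rw [hn]; simp only [hV, norm_opSqrt_sq hR]
      rw [hn3, div_mul_eq_mul_div, div_le_div_iff₀ (by positivity) hl']
      nlinarith) hτ
  refine (measure_mono fun z hz => ?_).trans key
  simp only [Set.mem_ofPred_eq] at hz ⊢
  rw [div_lt_iff₀ hl'] at hz
  refine hz.trans_le (le_of_eq ?_)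
  rw [← map_sum, mul_comm, ← Real.norm_of_nonneg hl'.le, ← norm_smul, ← map_smul, empVec,
    empOp_apply, ← smul_sub, smul_smul, ← Finset.sum_sub_distrib]
  simp [hl'.ne', ζ]

end Concentration

/-! ### Mean embeddings of bags -/

section MeanEmbeddings

variable {𝒳 : Type*} [MeasurableSpace 𝒳] {H : Type*} [NormedAddCommGroup H]
  [InnerProductSpace ℝ H] [CompleteSpace H] [RKHS ℝ H 𝒳 ℝ]
  (hφ : StronglyMeasurable (feature H : 𝒳 → H))

include hφ

theorem stronglyMeasurable_meanEmb : StronglyMeasurable (meanEmb H : ProbabilityMeasure 𝒳 → H) := by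
  let κ : Kernel (ProbabilityMeasure 𝒳) 𝒳 := ⟨fun x => (x : Measure 𝒳), measurable_subtype_coe⟩
  exact hφ.integral_kernel (κ := κ)

theorem meanEmb_empirical {N : ℕ} [NeZero N] (s : Fin N → 𝒳) :
    meanEmb H (empirical s) = (1 / (N : ℝ)) • ∑ n, feature H (s n) := by
  have h : ((empirical s : ProbabilityMeasure 𝒳) : Measure 𝒳)
      = (N : ℝ≥0∞)⁻¹ • ∑ n, Measure.dirac (s n) := rfl
  rw [meanEmb, h, integral_smul_measure, integral_finsetSum_measure]
  · simp only [integral_dirac' _ _ hφ]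
    simp
  · intro i _
    have : ∀ᵐ u ∂Measure.dirac (s i), ‖feature H u‖ ≤ ‖feature H (s i)‖ :=
      (ae_dirac_iff (measurableSet_le hφ.norm.measurable measurable_const)).2 le_rfl
    exact Integrable.of_bound hφ.aestronglyMeasurable _ this

theorem measure_bag_gt_le {Bk : ℝ} (hb : ∀ u : 𝒳, ‖feature H u‖ ≤ √Bk) (hBk : 0 ≤ Bk) {N : ℕ}
    [NeZero N] (x : ProbabilityMeasure 𝒳) {τ : ℝ} (hτ : 0 < τ) :
    (Measure.pi fun _ : Fin N => (x : Measure 𝒳))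
      {s | (1 + √τ) * √(2 * Bk) / √N < ‖meanEmb H (empirical s) - meanEmb H x‖}
      ≤ ENNReal.ofReal (Real.exp (-τ)) := by
  have hN : 0 < N := NeZero.pos N
  have hN' : (0 : ℝ) < N := Nat.cast_pos.2 hN
  have hi : Integrable (feature H : 𝒳 → H) (x : Measure 𝒳) :=
    Integrable.of_bound hφ.aestronglyMeasurable _ (ae_of_all _ hb)
  have hle : ∀ u : 𝒳, ‖feature H u‖ ^ 2 ≤ Bk := fun u => by
    rw [← Real.sq_sqrt hBk]; gcongr; exact hb u
  have hi2 : Integrable (fun u : 𝒳 => ‖feature H u‖ ^ 2) (x : Measure 𝒳) :=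
    Integrable.of_bound (hφ.norm.pow 2).aestronglyMeasurable Bk (ae_of_all _ fun u => by
      rw [Real.norm_of_nonneg (by positivity)]; exact hle u)
  have hvar : ∫ u, ‖feature H u - meanEmb H x‖ ^ 2 ∂(x : Measure 𝒳) ≤ Bk := by
    refine (integral_norm_sub_mean_sq_le (x : Measure 𝒳) hi hi2).2.trans ?_
    refine (integral_mono hi2 (integrable_const Bk) hle).trans ?_
    simp
  have key := measure_norm_sum_gt_le_of_oscillation_le (x : Measure 𝒳)
    (ξ := fun u => feature H u - meanEmb H x) (hφ.sub stronglyMeasurable_const) (c := 2 * √Bk)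
    (fun u u' => by
      rw [sub_sub_sub_cancel_right]
      exact (norm_sub_le _ _).trans (by linarith [hb u, hb u']))
    (by
      rw [integral_sub hi (integrable_const _)]
      simp [meanEmb]) hBk hvar hN hτ
  refine (measure_mono fun s hs => ?_).trans key
  simp only [Set.mem_ofPred_eq] at hs ⊢
  have h1 : ∑ i, (feature H (s i) - meanEmb H x)
      = (N : ℝ) • (meanEmb H (empirical s) - meanEmb H x) := by
    rw [meanEmb_empirical hφ, smul_sub, smul_smul, Finset.sum_sub_distrib]
    simp [hN'.ne', Nat.cast_smul_eq_nsmul]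
  rw [h1, norm_smul, Real.norm_of_nonneg hN'.le]
  have h2 := mul_lt_mul_of_pos_left hs hN'
  refine lt_of_le_of_lt ?_ h2
  have hsN : 0 < √(N : ℝ) := Real.sqrt_pos.2 hN'
  have e1 : (N : ℝ) = √N * √N := (Real.mul_self_sqrt hN'.le).symm
  have e2 : N * ((1 + √τ) * √(2 * Bk) / √N) = √N * √Bk * (√2 * (1 + √τ)) := by
    rw [Real.sqrt_mul (by norm_num)]
    field_simp
    rw [sq, ← e1]
    ring
  have e3 : √(N * Bk) = √N * √Bk := Real.sqrt_mul hN'.le _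
  have e4 : √(N * τ / 2) = √N * √τ / √2 := by
    rw [Real.sqrt_div (by positivity), Real.sqrt_mul hN'.le]
  have h22 : √2 * √2 = (2 : ℝ) := Real.mul_self_sqrt (by norm_num)
  have h21 : 1 ≤ √(2 : ℝ) := Real.one_le_sqrt.2 (by norm_num)
  have h20 : 0 < √(2 : ℝ) := by linarith
  have e5 : 2 * √Bk * (√N * √τ / √2) = √N * √Bk * (√2 * √τ) := by
    field_simp
    rw [sq, h22]
    ring
  rw [e2, e3, e4, e5]
  have : 0 ≤ √(N : ℝ) * √Bk * (√2 - 1) := by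
    have := sub_nonneg.2 h21
    positivity
  linarith

theorem compProd_bagKernel_gt_le {Bk : ℝ} (Q : Measure (ProbabilityMeasure 𝒳 × ℝ))
    [IsProbabilityMeasure Q] (hb : ∀ u : 𝒳, ‖feature H u‖ ≤ √Bk) (hBk : 0 ≤ Bk) {N : ℕ} [NeZero N] {τ : ℝ} (hτ : 0 < τ) :
    (Q ⊗ₘ bagKernel 𝒳 N)
      {ω | (1 + √τ) * √(2 * Bk) / √N < ‖meanEmb H (empirical ω.2) - meanEmb H ω.1.1‖}
      ≤ ENNReal.ofReal (Real.exp (-τ)) := by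
  have hm : StronglyMeasurable fun ω : (ProbabilityMeasure 𝒳 × ℝ) × (Fin N → 𝒳) =>
      meanEmb H (empirical ω.2) - meanEmb H ω.1.1 := by
    simp only [meanEmb_empirical hφ]
    exact (((stronglyMeasurable_pi_sum hφ N).comp_measurable measurable_snd).const_smul _).sub
      ((stronglyMeasurable_meanEmb hφ).comp_measurable (measurable_fst.comp measurable_fst))
  rw [Measure.compProd_apply (measurableSet_lt measurable_const hm.norm.measurable)]
  refine (lintegral_mono fun p : ProbabilityMeasure 𝒳 × ℝ =>
    measure_bag_gt_le hφ hb hBk p.1 hτ).trans ?_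
  simp

end MeanEmbeddings

/-! ### Two-stage sampling -/

section TwoStage

variable {𝒳 : Type*} [MeasurableSpace 𝒳] {H : Type*} [NormedAddCommGroup H]
  [InnerProductSpace ℝ H] [CompleteSpace H] [MeasurableSpace H] [RKHS ℝ H 𝒳 ℝ]
  (Q : Measure (ProbabilityMeasure 𝒳 × ℝ)) [IsProbabilityMeasure Q]

theorem measurable_toEmb [BorelSpace H] (hφ : StronglyMeasurable (feature H : 𝒳 → H)) :
    Measurable (toEmb H : ProbabilityMeasure 𝒳 → embSet H) :=
  (stronglyMeasurable_meanEmb hφ).measurable.subtype_mk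

variable (H) in
/-- The first-stage observation `(μ_x, y)` contained in a draw of the two-stage sample. -/
noncomputable def firstStage {N : ℕ} (ω : (ProbabilityMeasure 𝒳 × ℝ) × (Fin N → 𝒳)) :
    embSet H × ℝ :=
  (toEmb H ω.1.1, ω.1.2)

theorem measurePreserving_fst_compProd (N : ℕ) :
    MeasurePreserving Prod.fst (Q ⊗ₘ bagKernel 𝒳 N) Q :=
  ⟨measurable_fst, Measure.fst_compProd Q (bagKernel 𝒳 N)⟩

theorem measurePreserving_firstStage (hm : Measurable (toEmb H : ProbabilityMeasure 𝒳 → embSet H))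
    (N : ℕ) : MeasurePreserving (firstStage H) (Q ⊗ₘ bagKernel 𝒳 N) (rho H Q) := by
  have h1 : MeasurePreserving (fun p : ProbabilityMeasure 𝒳 × ℝ => (toEmb H p.1, p.2)) Q
      (rho H Q) :=
    ⟨(hm.comp measurable_fst).prodMk measurable_snd, rfl⟩
  exact h1.comp (measurePreserving_fst_compProd Q N)

/-- Stated as an inequality of outer measures so that the exceptional sets need not be shown
measurable. -/
theorem sampleLaw_firstStage_le (hm : Measurable (toEmb H : ProbabilityMeasure 𝒳 → embSet H))
    [IsProbabilityMeasure (rho H Q)] (l N : ℕ) (A : Set (Fin l → embSet H × ℝ)) :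
    sampleLaw Q l N {w | (fun i => firstStage H (w i)) ∈ A}
      ≤ (Measure.pi fun _ : Fin l => rho H Q) A := by
  have h := measurePreserving_pi (fun _ : Fin l => Q ⊗ₘ bagKernel 𝒳 N) (fun _ => rho H Q)
    fun _ => measurePreserving_firstStage Q hm N
  rw [← h.map_eq]
  exact Measure.le_map_apply h.measurable.aemeasurable A

theorem sampleLaw_exists_le (l N : ℕ) (A : Set ((ProbabilityMeasure 𝒳 × ℝ) × (Fin N → 𝒳))) :
    sampleLaw Q l N {w | ∃ i, w i ∈ A} ≤ l * (Q ⊗ₘ bagKernel 𝒳 N) A := by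
  have h1 : {w : Fin l → (ProbabilityMeasure 𝒳 × ℝ) × (Fin N → 𝒳) | ∃ i, w i ∈ A}
      = ⋃ i, Function.eval i ⁻¹' A := by ext w; simp
  rw [h1]
  refine (measure_iUnion_le _).trans ?_
  rw [tsum_fintype]
  refine (Finset.sum_le_sum (g := fun _ => (Q ⊗ₘ bagKernel 𝒳 N) A) fun i _ => ?_).trans (by simp)
  have h := measurePreserving_eval (fun _ : Fin l => Q ⊗ₘ bagKernel 𝒳 N) i
  conv_rhs => rw [← h.map_eq]
  exact Measure.le_map_apply h.measurable.aemeasurable A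

theorem sampleLaw_isProbabilityMeasure (l N : ℕ) : IsProbabilityMeasure (sampleLaw Q l N) := by
  unfold sampleLaw; infer_instance

/-- A set of small outer measure has a measurable complement part of large measure. -/
theorem exists_measurableSet_subset_compl {Ω : Type*} [MeasurableSpace Ω] (P : Measure Ω)
    [IsProbabilityMeasure P] (A : Set Ω) {ε : ℝ} (hε : 0 ≤ ε) (hA : P A ≤ ENNReal.ofReal ε) :
    ∃ G, MeasurableSet G ∧ 1 - ε ≤ P.real G ∧ ∀ w ∈ G, w ∉ A := by
  refine ⟨(toMeasurable P A)ᶜ, (measurableSet_toMeasurable P A).compl, ?_,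
    fun w hw hwA => hw (subset_toMeasurable P A hwA)⟩
  rw [probReal_compl_eq_one_sub (measurableSet_toMeasurable P A)]
  have : P.real (toMeasurable P A) ≤ ε := by
    rw [measureReal_def, measure_toMeasurable]
    exact ENNReal.toReal_le_of_le_ofReal hε hA
  linarith

end TwoStage

/-! ### Elementary estimates for the rates -/

section Rates

theorem one_le_log_six_div {η : ℝ} (h0 : 0 < η) (h1 : η < 1) : 1 ≤ Real.log (6 / η) := by
  rw [Real.le_log_iff_exp_le (by positivity)]
  have h2 := Real.exp_one_lt_d9
  have h3 : 6 ≤ 6 / η := by rw [le_div_iff₀ h0]; linarith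
  linarith

theorem two_mul_exp_neg_log_six_div {η : ℝ} (h0 : 0 < η) :
    2 * Real.exp (-Real.log (6 / η)) = η / 3 := by
  rw [Real.exp_neg, Real.exp_log (by positivity)]
  field_simp
  norm_num

/-- The square root term contributes at most `l / 4`. The linear term contributes at most `l / 8`,
using `β ≤ 2 β n`, which is where `1 / 2 ≤ n` is needed. -/
theorem bernstein_threshold_le_half {β n τ : ℝ} {l : ℝ} (hβ : 0 ≤ β) (hn : 1 / 2 ≤ n) (hτ : 1 ≤ τ)
    (hl : 64 * τ ^ 2 * (β * n) ≤ l) :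
    2 * (2 * β + √(l * (β * n))) * τ ≤ l / 2 := by
  have hβn : 0 ≤ β * n := mul_nonneg hβ (by linarith)
  have hl0 : 0 ≤ l := le_trans (by positivity) hl
  have h1 : √(l * (β * n)) ≤ l / (8 * τ) := by
    refine Real.sqrt_le_left (by positivity) |>.2 ?_ |> fun h => h
    rw [div_pow, le_div_iff₀ (by positivity)]
    nlinarith
  have h2 : √(l * (β * n)) * τ ≤ l / 8 := by
    calc _ ≤ l / (8 * τ) * τ := by gcongr
      _ = l / 8 := by field_simp
  have h3 : 32 * τ * β ≤ l := by
    have h4 : β / 2 ≤ β * n := by nlinarith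
    have h5 : τ * (β / 2) ≤ τ ^ 2 * (β * n) := by
      have : τ ≤ τ ^ 2 := by nlinarith
      gcongr
    linarith
  nlinarith

theorem noise_rate {τ l D a c : ℝ} (ha : 0 ≤ a) (hc : 0 ≤ c) (hl : 0 < l)
    (hD : D = √a + √(l * c)) {x : ℝ} (hx0 : 0 ≤ x) (hx : x ≤ 2 * D * τ / l) :
    x ^ 2 ≤ 8 * τ ^ 2 * (a / l ^ 2 + c / l) := by
  have h1 : D ^ 2 ≤ 2 * (a + l * c) := by
    have h2 := Real.sq_sqrt ha
    have h3 := Real.sq_sqrt (mul_nonneg hl.le hc)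
    rw [hD]
    nlinarith [sq_nonneg (√a - √(l * c))]
  calc x ^ 2 ≤ (2 * D * τ / l) ^ 2 := by gcongr
    _ = 4 * τ ^ 2 / l ^ 2 * D ^ 2 := by field_simp; ring
    _ ≤ 4 * τ ^ 2 / l ^ 2 * (2 * (a + l * c)) := by gcongr
    _ = _ := by field_simp; ring

theorem rpow_bag_rate {t Bk h : ℝ} {N : ℝ} (ht : 0 ≤ t) (hBk : 0 ≤ Bk) (hN : 0 < N) :
    ((t * √(2 * Bk) / √N) ^ h) ^ 2 = t ^ (2 * h) * (2 * Bk) ^ h / N ^ h := by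
  have hc : ∀ x : ℝ, 0 ≤ x → (x ^ h) ^ 2 = (x ^ 2) ^ h := fun x hx => by
    rw [← Real.rpow_natCast, ← Real.rpow_mul hx, ← Real.rpow_natCast x 2, ← Real.rpow_mul hx,
      mul_comm]
  rw [hc _ (by positivity), div_pow, mul_pow, Real.sq_sqrt (by positivity), Real.sq_sqrt hN.le,
    Real.div_rpow (by positivity) hN.le, Real.mul_rpow (by positivity) (by positivity),
    ← Real.rpow_natCast t 2, ← Real.rpow_mul ht]
  norm_num

/-- The condition on `N` is `64 BK L² r^(2h) ≤ λ²` raised to the power `1 / h`. Here `2 ^ ((h + 6) /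
h) = 2 * 64 ^ (1 / h)`: the 2 comes from `2 * Bk`, and `64 = 4 * 16` from squaring the factor 2 and
the 1/4. -/
theorem perturbation_le_of_bag_size {t Bk BK L h N lam : ℝ} (ht : 0 ≤ t) (hBk : 0 ≤ Bk)
    (hBK : 0 < BK) (hL : 0 ≤ L) (hh : 0 < h) (hN : 0 < N) (hlam : 0 < lam)
    (hle : t ^ 2 * (2 : ℝ) ^ ((h + 6) / h) * Bk * BK ^ (1 / h) * L ^ (2 / h) / lam ^ (2 / h) ≤ N) :
    2 * √BK * (L * (t * √(2 * Bk) / √N) ^ h) ≤ lam / 4 := by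
  set r := t * √(2 * Bk) / √N with hr
  have hr0 : 0 ≤ r := by positivity
  have hr2 : r ^ 2 = t ^ 2 * (2 * Bk) / N := by
    rw [hr, div_pow, mul_pow, Real.sq_sqrt (by positivity), Real.sq_sqrt hN.le]
  have hlamp : 0 < lam ^ (2 / h) := by positivity
  have h64 : (2 : ℝ) ^ ((h + 6) / h) = 2 * 64 ^ (1 / h) := by
    have e : (h + 6) / h = 1 + 6 * (1 / h) := by field_simp
    rw [e, Real.rpow_add (by norm_num), Real.rpow_one, Real.rpow_mul (by norm_num)]
    norm_num
  have hsq : ∀ x : ℝ, 0 ≤ x → x ^ (2 / h) = (x ^ 2) ^ (1 / h) := fun x hx => by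
    rw [← Real.rpow_natCast x 2, ← Real.rpow_mul hx]
    congr 1
    push_cast
    ring
  have h1 : r ^ 2 * (64 * BK * L ^ 2) ^ (1 / h) ≤ (lam ^ 2) ^ (1 / h) := by
    rw [div_le_iff₀ hlamp, h64, hsq L hL, hsq lam hlam.le] at hle
    rw [hr2, Real.mul_rpow (by positivity) (by positivity),
      Real.mul_rpow (by norm_num) hBK.le, div_mul_eq_mul_div, div_le_iff₀ hN]
    linarith
  have h2 : (r ^ h) ^ 2 * (64 * BK * L ^ 2) ≤ lam ^ 2 := by
    have h3 := Real.rpow_le_rpow (by positivity) h1 hh.le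
    rw [Real.mul_rpow (by positivity) (by positivity), ← Real.rpow_mul (by positivity),
      ← Real.rpow_mul (by positivity), one_div, inv_mul_cancel₀ hh.ne', Real.rpow_one,
      Real.rpow_one] at h3
    have h4 : (r ^ 2) ^ h = (r ^ h) ^ 2 := by
      rw [← Real.rpow_natCast, ← Real.rpow_mul hr0, ← Real.rpow_natCast (r ^ h),
        ← Real.rpow_mul hr0, mul_comm]
    rwa [h4] at h3
  have h5 : (2 * √BK * (L * r ^ h)) ^ 2 ≤ (lam / 4) ^ 2 := by
    have : (2 * √BK * (L * r ^ h)) ^ 2 = 4 * BK * (L ^ 2 * (r ^ h) ^ 2) := by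
      rw [mul_pow, mul_pow, Real.sq_sqrt hBK.le]; ring
    rw [this]
    linarith
  exact (sq_le_sq₀ (by positivity) (by positivity)).1 h5

end Rates

/-! ### The excess risk on the good event -/

section ExcessRisk

variable {S : Type*} {F : Type*} [NormedAddCommGroup F] [InnerProductSpace ℝ F] [CompleteSpace F]
  [RKHS ℝ F S ℝ]

theorem inner_sub_resolv_empOp_le {b : ℝ} (hb0 : 0 ≤ b) (hb : ∀ t : S, ‖feature F t‖ ≤ b)
    {T : F →L[ℝ] F} (hT : T.IsPositive) {lam : ℝ} (hlam : 0 < lam) {l : ℕ} [NeZero l]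
    {a a' : Fin l → S} {y : Fin l → ℝ} {C ε τ M Sig n : ℝ} (hy : ∀ i, |y i| ≤ C)
    (hε : ∀ i, ‖feature F (a' i) - feature F (a i)‖ ≤ ε) (hpert : 2 * b * ε ≤ lam / 4)
    (hM : 0 ≤ M) (hn : 0 ≤ n) {f₀ d : F} (hd : d = resolv T lam (T f₀) - f₀)
    (hloew : ∀ u : F, inner ℝ (T u) u ≤ 2 * inner ℝ (empOp F a u) u + lam * ‖u‖ ^ 2)
    (hnoise : ‖opSqrt (resolv T lam) (empVec F a y - empOp F a f₀)‖
      ≤ 2 * (M * √(b ^ 2 / lam) + √(l * (Sig ^ 2 * n))) * τ / l)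
    (hcov : ‖T d - empOp F a d‖
      ≤ 2 * (2 * (b ^ 2 * ‖d‖) + √(l * (b ^ 2 * inner ℝ (T d) d))) * τ / l) :
    inner ℝ (T (resolv (empOp F a') lam (empVec F a' y) - f₀))
        (resolv (empOp F a') lam (empVec F a' y) - f₀)
      ≤ 5 * (4 * C ^ 2 * ε ^ 2 / lam * (1 + 4 * (b ^ 2) ^ 2 / lam ^ 2) + inner ℝ (T d) d
        + 32 * τ ^ 2 * ((b ^ 2) ^ 2 * ‖d‖ ^ 2 / ((l : ℝ) ^ 2 * lam)
          + b ^ 2 * inner ℝ (T d) d / (4 * l * lam) + b ^ 2 * M ^ 2 / ((l : ℝ) ^ 2 * lam)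
          + Sig ^ 2 * n / l)) := by
  have hl : (0 : ℝ) < l := Nat.cast_pos.2 (NeZero.pos l)
  have hTd := inner_apply_self_nonneg hT d
  have hpert' : ∀ u, ‖empOp F a u - empOp F a' u‖ ≤ lam / 4 * ‖u‖ := fun u => by
    rw [norm_sub_rev]
    exact (norm_empOp_sub_le a hb a' hε u).trans (by gcongr)
  have i₀ : Fin l := ⟨0, NeZero.pos l⟩
  have hε0 : 0 ≤ ε := (norm_nonneg _).trans (hε i₀)
  have hC0 : 0 ≤ C := (abs_nonneg _).trans (hy i₀)
  refine (inner_sub_resolv_le hT (empOp_isPositive a) (empOp_isPositive a') hlam hloew hpert' f₀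
    (empVec F a y) (empVec F a' y)).trans ?_
  rw [← hd, ← norm_opSqrt_sq (resolv_isPositive hT hlam)]
  have h1 : ‖empVec F a' y - empVec F a y‖ ^ 2 ≤ (C * ε) ^ 2 := by
    have := norm_empVec_sub_le a y a' hε hy
    gcongr
  have h2 : ‖empOp F a (resolv (empOp F a) lam (empVec F a y))
      - empOp F a' (resolv (empOp F a) lam (empVec F a y))‖ ^ 2
      ≤ (2 * b * ε * (C * b / lam)) ^ 2 := by
    have h3 : ‖resolv (empOp F a) lam (empVec F a y)‖ ≤ C * b / lam :=
      (norm_resolv_apply_le (empOp_isPositive a) hlam _).trans (by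
        gcongr
        exact norm_empVec_le a y hb hy)
    rw [norm_sub_rev]
    gcongr
    exact (norm_empOp_sub_le a hb a' hε _).trans (by gcongr)
  have h4 := noise_rate (a := M ^ 2 * (b ^ 2 / lam)) (c := Sig ^ 2 * n) (by positivity)
    (by positivity) hl (by rw [Real.sqrt_mul (sq_nonneg M), Real.sqrt_sq hM]) (norm_nonneg _) hnoise
  have h5 := noise_rate (a := (2 * (b ^ 2 * ‖d‖)) ^ 2) (c := b ^ 2 * inner ℝ (T d) d)
    (by positivity) (by positivity) hl (by rw [Real.sqrt_sq (by positivity)]) (norm_nonneg _) hcov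
  gcongr 5 * ?_
  -- The noise carries `4 * 8τ² = 32τ²`. In the covariance term `8τ² * 4 = 32τ²` on the `‖d‖²` part,
  -- so its other part acquires the factor 1/4.
  calc _ ≤ 4 / lam * (C * ε) ^ 2 + 4 / lam * (2 * b * ε * (C * b / lam)) ^ 2 + inner ℝ (T d) d
        + 4 * (8 * τ ^ 2 * (M ^ 2 * (b ^ 2 / lam) / l ^ 2 + Sig ^ 2 * n / l))
        + 1 / lam * (8 * τ ^ 2 * ((2 * (b ^ 2 * ‖d‖)) ^ 2 / l ^ 2
          + b ^ 2 * inner ℝ (T d) d / l)) := by gcongr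
    _ = _ := by field_simp; ring

end ExcessRisk

end DistReg

/-! ### The theorem: assembling the good event. -/

open DistReg in
theorem theorem1
    {𝒳 : Type*} [TopologicalSpace 𝒳] [TopologicalSpace.SeparableSpace 𝒳]
    [MeasurableSpace 𝒳] [BorelSpace 𝒳]
    -- the Hilbert space `H = H(k)` of the kernel `k` on `𝒳`
    {H : Type*} [NormedAddCommGroup H] [InnerProductSpace ℝ H] [CompleteSpace H]
    [MeasurableSpace H] [BorelSpace H] [RKHS ℝ H 𝒳 ℝ]
    -- the Hilbert space `𝓗 = 𝓗(K)` of the kernel `K` on the set `X ⊆ H` of mean embeddings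
    {𝓗 : Type*} [NormedAddCommGroup 𝓗] [InnerProductSpace ℝ 𝓗] [CompleteSpace 𝓗]
    [RKHS ℝ 𝓗 (DistReg.embSet H) ℝ]
    (Bk BK : ℝ)
    (hk_cont : Continuous fun p : 𝒳 × 𝒳 => DistReg.kerVal H p.1 p.2)
    (hk_bdd : ∀ u : 𝒳, DistReg.kerVal H u u ≤ Bk)
    (hK_bdd : ∀ a : DistReg.embSet H, DistReg.kerVal 𝓗 a a ≤ BK)
    (L h : ℝ≥0) (hh_pos : 0 < h) (hh_le : h ≤ 1)
    (hK_holder : HolderWith L h fun a : DistReg.embSet H => DistReg.feature 𝓗 a)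
    -- the meta distribution of `(x, y)`
    (Q : Measure (ProbabilityMeasure 𝒳 × ℝ)) [IsProbabilityMeasure Q]
    (C : ℝ) (hC : 0 < C) (hy : ∀ᵐ p ∂Q, |p.2| ≤ C)
    (fH : 𝓗) (hfH : ∀ f : 𝓗, DistReg.risk Q fH ≤ DistReg.risk Q f)
    (M Sig : ℝ) (hM : 0 < M) (hSig : 0 < Sig) (hnoise : DistReg.NoiseBound Q fH M Sig)
    (l N : ℕ) [NeZero l] [NeZero N] (lam η δ : ℝ)
    (hlam : 0 < lam) (hη_pos : 0 < η) (hη_lt : η < 1) (hδ : 0 < δ)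
    (hl : 2 * DistReg.Ceta η * BK * DistReg.effDim 𝓗 Q lam / lam ≤ (l : ℝ))
    (hlamT : lam ≤ ‖DistReg.covOp 𝓗 Q‖)
    (hN : (1 + √(Real.log l + δ)) ^ 2 * (2 : ℝ) ^ (((h : ℝ) + 6) / (h : ℝ)) * Bk
        * BK ^ (1 / (h : ℝ)) * (L : ℝ) ^ (2 / (h : ℝ)) / lam ^ (2 / (h : ℝ)) ≤ (N : ℝ)) :
    ∃ G : Set (Fin l → (ProbabilityMeasure 𝒳 × ℝ) × (Fin N → 𝒳)),
      MeasurableSet G ∧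
      1 - η - Real.exp (-δ) ≤ (DistReg.sampleLaw Q l N).real G ∧
      ∀ w ∈ G,
        DistReg.risk Q (DistReg.merr 𝓗 lam w) - DistReg.risk Q fH ≤
          5 * (4 * (L : ℝ) ^ 2 * C ^ 2 * (1 + √(Real.log l + δ)) ^ (2 * (h : ℝ))
                * (2 * Bk) ^ (h : ℝ) / (lam * (N : ℝ) ^ (h : ℝ)) * (1 + 4 * BK ^ 2 / lam ^ 2)
              + DistReg.residual Q fH lam
              + DistReg.Ceta η *
                (BK ^ 2 * DistReg.reconErr Q fH lam / ((l : ℝ) ^ 2 * lam)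
                  + BK * DistReg.residual Q fH lam / (4 * l * lam)
                  + BK * M ^ 2 / ((l : ℝ) ^ 2 * lam)
                  + Sig ^ 2 * DistReg.effDim 𝓗 Q lam / l)) := by
  obtain ⟨p₀⟩ : Nonempty (ProbabilityMeasure 𝒳 × ℝ) := nonempty_of_isProbabilityMeasure Q
  obtain ⟨u₀⟩ : Nonempty 𝒳 := nonempty_of_isProbabilityMeasure (p₀.1 : Measure 𝒳)
  have hl0 : 0 < l := NeZero.pos l
  have hl' : (0 : ℝ) < l := Nat.cast_pos.2 hl0
  have hN' : (0 : ℝ) < N := Nat.cast_pos.2 (NeZero.pos N)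
  have hBk : 0 ≤ Bk := (norm_feature_sq (F := H) u₀ ▸ sq_nonneg _).trans (hk_bdd u₀)
  -- the Hilbert space of the kernel on points
  have hφc : Continuous (feature H : 𝒳 → H) := continuous_feature_of_continuous_kerVal hk_cont
  have hHsep : TopologicalSpace.SeparableSpace H := separableSpace_of_continuous_feature hφc
  have hH2 : SecondCountableTopology H := UniformSpace.secondCountable_of_separable H
  have hφm : StronglyMeasurable (feature H : 𝒳 → H) := hφc.stronglyMeasurable
  have hφb : ∀ u : 𝒳, ‖feature H u‖ ≤ √Bk := norm_feature_le hk_bdd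
  have hemb : Measurable (toEmb H : ProbabilityMeasure 𝒳 → embSet H) := measurable_toEmb hφm
  -- the Hilbert space of the kernel on mean embeddings
  have hψc : Continuous (feature 𝓗 : embSet H → 𝓗) := hK_holder.continuous hh_pos
  have h𝓗sep : TopologicalSpace.SeparableSpace 𝓗 := separableSpace_of_continuous_feature hψc
  have hψb : ∀ a : embSet H, ‖feature 𝓗 a‖ ≤ √BK := norm_feature_le hK_bdd
  have hrhom : Measurable fun p : ProbabilityMeasure 𝒳 × ℝ => (toEmb H p.1, p.2) :=
    (hemb.comp measurable_fst).prodMk measurable_snd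
  have hν : IsProbabilityMeasure (rho H Q) := Measure.isProbabilityMeasure_map hrhom.aemeasurable
  have hyν : ∀ᵐ z ∂(rho H Q), |z.2| ≤ C := by
    unfold rho
    rw [ae_map_iff hrhom.aemeasurable
      (measurableSet_le measurable_snd.abs measurable_const)]
    exact hy
  set T := covOp 𝓗 Q with hT
  have hTp : T.IsPositive := integral_pointOp_isPositive hψc hψb (rho H Q).fst
  set n := effDim 𝓗 Q lam with hn
  have hn_eq : n = ∫ a, inner ℝ (resolv T lam (feature 𝓗 a)) (feature 𝓗 a) ∂(rho H Q).fst :=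
    opTrace_resolv_comp hψc hψb (rho H Q).fst hlam
  have hn_half : 1 / 2 ≤ n := by
    rw [hn_eq]; exact half_le_integral_inner_resolv hψc hψb (rho H Q).fst hlam hlamT
  -- Otherwise all features vanish, and so does the effective dimension, against `1 / 2 ≤ n`.
  have hBK : 0 < BK := by
    by_contra hneg
    push Not at hneg
    have h0 : ∀ a : embSet H, feature 𝓗 a = 0 := fun a => by
      have := hψb a
      rw [Real.sqrt_eq_zero'.2 hneg] at this
      exact norm_le_zero_iff.1 this
    have : n = 0 := by rw [hn_eq]; simp [h0]
    linarith
  have hb0 : 0 < √BK := Real.sqrt_pos.2 hBK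
  have hb2 : √BK ^ 2 = BK := Real.sq_sqrt hBK.le
  -- quadratic form of the risk
  have hrisk : ∀ f : 𝓗, risk Q f = inner ℝ (T f) f
      - 2 * inner ℝ (∫ z, z.2 • feature 𝓗 z.1 ∂(rho H Q)) f + ∫ z, z.2 ^ 2 ∂(rho H Q) :=
    integral_sq_sub_eq hψc hψb (rho H Q) hyν
  have hTf : T fH = ∫ z, z.2 • feature 𝓗 z.1 ∂(rho H Q) := apply_eq_of_isMin hTp hrisk hfH
  have hfl : fReg 𝓗 Q lam = resolv T lam (T fH) := by
    rw [hTf]; exact argmin_add_regularizer hTp hrisk hlam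
  have hmerr : ∀ w : Fin l → (ProbabilityMeasure 𝒳 × ℝ) × (Fin N → 𝒳), merr 𝓗 lam w
      = resolv (empOp 𝓗 fun i => toEmb H (empirical (w i).2)) lam
        (empVec 𝓗 (fun i => toEmb H (empirical (w i).2)) fun i => (w i).1.2) := fun w =>
    argmin_add_regularizer (empOp_isPositive _) (empirical_risk_eq _ _) hlam
  set d := fReg 𝓗 Q lam - fH with hd
  have hres : residual Q fH lam = inner ℝ (T d) d := norm_opSqrt_sq hTp d
  have hTd := inner_apply_self_nonneg hTp d
  -- confidence levels
  set τ := Real.log (6 / η) with hτ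
  have hτ1 : 1 ≤ τ := one_le_log_six_div hη_pos hη_lt
  have hτη : 2 * Real.exp (-τ) = η / 3 := two_mul_exp_neg_log_six_div hη_pos
  -- The confidence level for a single bag; the factor `l` of the union bound is cancelled by `exp
  -- (-log l)`.
  have hlog : 0 < Real.log l + δ :=
    add_pos_of_nonneg_of_pos (Real.log_natCast_nonneg l) hδ
  -- the exceptional sets
  obtain ⟨G₁, -, hG₁, hloew⟩ := measure_not_loewner_le hψc hψb (rho H Q) hlam hl0 hb0 hτ1 hn_eq (by
    rw [hb2]
    refine bernstein_threshold_le_half (by positivity) hn_half hτ1 (le_trans (le_of_eq ?_) hl)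
    rw [Ceta]
    field_simp
    ring)
  set A₂ : Set (Fin l → embSet H × ℝ) :=
    {z | 2 * (M * √(√BK ^ 2 / lam) + √(l * (Sig ^ 2 * n))) * τ / l <
      ‖opSqrt (resolv T lam)
        (empVec 𝓗 (fun i => (z i).1) (fun i => (z i).2) - empOp 𝓗 (fun i => (z i).1) fH)‖} with hA₂
  have hA₂le : (Measure.pi fun _ : Fin l => rho H Q) A₂ ≤ ENNReal.ofReal (2 * Real.exp (-τ)) :=
    measure_noise_gt_le hψc hψb (rho H Q) hyν hlam hl0 hb0 hτ1 hn_eq hTf hM hSig hnoise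
  set A₃ : Set (Fin l → embSet H × ℝ) :=
    {z | 2 * (2 * (√BK ^ 2 * ‖d‖) + √(l * (√BK ^ 2 * inner ℝ (T d) d))) * τ / l <
      ‖T d - empOp 𝓗 (fun i => (z i).1) d‖} with hA₃
  have hA₃le : (Measure.pi fun _ : Fin l => rho H Q) A₃ ≤ ENNReal.ofReal (2 * Real.exp (-τ)) := by
    -- Bernstein's inequality needs a positive scale, so a vanishing bias is treated apart; both
    -- sides are then zero.
    rcases eq_or_ne d 0 with h0 | h0
    · have : A₃ = ∅ := by
        ext z
        simp [hA₃, h0]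
      rw [this]
      simp
    · have : 0 < ‖d‖ := norm_pos_iff.2 h0
      exact measure_norm_cov_sub_empOp_gt_le hψc hψb (rho H Q) d hl0 (by positivity) hτ1
  set r := (1 + √(Real.log l + δ)) * √(2 * Bk) / √N with hr
  set A₄ : Set ((ProbabilityMeasure 𝒳 × ℝ) × (Fin N → 𝒳)) :=
    {ω | r < ‖meanEmb H (empirical ω.2) - meanEmb H ω.1.1‖} with hA₄
  have hA₄le : (Q ⊗ₘ bagKernel 𝒳 N) A₄ ≤ ENNReal.ofReal (Real.exp (-(Real.log l + δ))) :=
    compProd_bagKernel_gt_le hφm Q hφb hBk hlog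
  -- Labels are bounded only almost surely, so the null event of an oversized label is excluded too.
  set A₅ : Set ((ProbabilityMeasure 𝒳 × ℝ) × (Fin N → 𝒳)) := {ω | ¬|ω.1.2| ≤ C} with hA₅
  have hA₅le : (Q ⊗ₘ bagKernel 𝒳 N) A₅ = 0 :=
    (measurePreserving_fst_compProd Q N).quasiMeasurePreserving.ae hy
  set Bad : Set (Fin l → (ProbabilityMeasure 𝒳 × ℝ) × (Fin N → 𝒳)) :=
    {w | (fun i => firstStage H (w i)) ∈ G₁ᶜ ∪ A₂ ∪ A₃} ∪ {w | ∃ i, w i ∈ A₄}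
      ∪ {w | ∃ i, w i ∈ A₅} with hBad
  have hP := sampleLaw_isProbabilityMeasure Q l N
  have hBadle : sampleLaw Q l N Bad ≤ ENNReal.ofReal (η + Real.exp (-δ)) := by
    have h1 : sampleLaw Q l N {w | (fun i => firstStage H (w i)) ∈ G₁ᶜ ∪ A₂ ∪ A₃}
        ≤ ENNReal.ofReal η := by
      refine (sampleLaw_firstStage_le Q hemb l N _).trans ?_
      refine ((measure_union_le _ _).trans (add_le_add ((measure_union_le _ _).trans
        (add_le_add hG₁ hA₂le)) hA₃le)).trans (le_of_eq ?_)
      rw [hτη, ← ENNReal.ofReal_add (by positivity) (by positivity),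
        ← ENNReal.ofReal_add (by positivity) (by positivity)]
      congr 1
      ring
    have h2 : sampleLaw Q l N {w | ∃ i, w i ∈ A₄} ≤ ENNReal.ofReal (Real.exp (-δ)) := by
      refine (sampleLaw_exists_le Q l N A₄).trans ?_
      refine (mul_le_mul_right hA₄le _).trans (le_of_eq ?_)
      rw [← ENNReal.ofReal_natCast, ← ENNReal.ofReal_mul hl'.le, neg_add, Real.exp_add,
        Real.exp_neg, Real.exp_log hl', mul_inv_cancel_left₀ hl'.ne']
    have h3 : sampleLaw Q l N {w | ∃ i, w i ∈ A₅} ≤ 0 := by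
      refine (sampleLaw_exists_le Q l N A₅).trans ?_
      rw [hA₅le, mul_zero]
    refine ((measure_union_le _ _).trans (add_le_add ((measure_union_le _ _).trans
      (add_le_add h1 h2)) h3)).trans (le_of_eq ?_)
    rw [add_zero, ← ENNReal.ofReal_add hη_pos.le (Real.exp_pos _).le]
  obtain ⟨G, hGm, hGP, hG⟩ := exists_measurableSet_subset_compl (sampleLaw Q l N) Bad
    (by positivity) hBadle
  refine ⟨G, hGm, by linarith, fun w hw => ?_⟩
  have hgood := hG w hw
  simp only [hBad, Set.mem_union, Set.mem_ofPred_eq, not_or, Set.mem_compl_iff, not_not,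
    not_exists] at hgood
  obtain ⟨⟨⟨⟨hw₁, hw₂⟩, hw₃⟩, hw₄⟩, hw₅⟩ := hgood
  rw [hA₂, Set.mem_ofPred_eq, not_lt] at hw₂
  rw [hA₃, Set.mem_ofPred_eq, not_lt] at hw₃
  simp only [hA₄, Set.mem_ofPred_eq, not_lt] at hw₄
  simp only [hA₅, Set.mem_ofPred_eq, not_not] at hw₅
  have hfeat : ∀ i, ‖feature 𝓗 (toEmb H (empirical (w i).2)) - feature 𝓗 (firstStage H (w i)).1‖
      ≤ L * r ^ (h : ℝ) := fun i => by
    rw [← dist_eq_norm]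
    refine (hK_holder.dist_le _ _).trans ?_
    gcongr
    rw [Subtype.dist_eq, dist_eq_norm]
    exact hw₄ i
  have hfinal := inner_sub_resolv_empOp_le hb0.le hψb hTp hlam
    (a := fun i => (firstStage H (w i)).1)
    (y := fun i => (w i).1.2) hw₅ hfeat
    (perturbation_le_of_bag_size (by positivity) hBk hBK L.2 hh_pos hN' hlam hN) hM.le
    (by linarith) (f₀ := fH) (d := d) (by rw [hd, hfl]) (hloew _ hw₁) hw₂ hw₃
  rw [sub_eq_inner_of_isMin hTp hrisk hfH, hmerr]
  refine hfinal.trans (le_of_eq ?_)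
  rw [hres, reconErr, ← hd, hb2, mul_pow, rpow_bag_rate (by positivity) hBk hN', Ceta]
  congr 3
  field_simp
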